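/- **Theorem 1 (slice energy in general relativity).** Let $M$ be a smooth (Hausdorff, second countable) manifold of dimension $n$ without boundary, and let $g$ be a smooth Lorentzian metric of signature $(+,-,\dots,-)$ on $\mathcal V=M\times\mathbb R$ for which every slice $M_t=M\times\{t\}$ is spacelike; time-orient $\mathcal V$ so that $t$ increases to the future. Let $N$ be the future-directed unit normal to the slices, $d\mu_t$ the volume element on $M_t$ of the spatial metric $g_t=-g|_{M_t}$, and $d\mu$ the volume element of $g$. Let $X$ be a smooth causal vector field on $\mathcal V$. For a symmetric stress tensor $T$ put $P^\beta=X_\alpha T^{\alpha\beta}$ and $E_t=\int_{M_t}P^\alpha N_\alpha\,d\mu_t$ (the slice energy, relative to $X$, of the field with stress tensor $T$). Let $V:\mathbb R\to\mathbb R$ be a smooth potential and $\phi$ a smooth scalar field on $\mathcal V$ with stress tensor $$T_{\alpha\beta}(\phi)=\partial_\alpha\phi\,\partial_\beta\phi-\tfrac12 g_{\alpha\beta}\bigl(\partial^\lambda\phi\,\partial_\lambda\phi-2V(\phi)\bigr),$$ and let $\psi$ be a matter field with smooth symmetric stress tensor $T_{\alpha\beta}(\psi)$. Suppose that the Einstein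 equations $$G_{\alpha\beta}=T_{\alpha\beta}(\phi)+T_{\alpha\beta}(\psi),\qquad G_{\alpha\beta}=R_{\alpha\beta}-\tfrac12 R\,g_{\alpha\beta},$$ hold and that $\nabla_\alpha T^{\alpha\beta}(\phi)=0$ and $\nabla_\alpha T^{\alpha\beta}(\psi)=0$. Let $t_0\le t_1$, and suppose that either $M$ is compact, or each of the two fields falls off at spatial infinity in the following sense: its energy densities $P^\alpha N_\alpha$ on $M_{t_0}$ and on $M_{t_1}$ are integrable, and there is a smooth function $r:M\to\mathbb R$ tending to $+\infty$ at infinity on $M$ such that $\int_{t_0}^{t_1}\int_{M_t}|P^\alpha\partial_\alpha r|\,d\mu<\infty$. Then the energy densities of $\phi$ and of $\psi$ and the function $G^{\alpha\beta}X_\alpha N_\beta$ are integrable on $M_{t_0}$ and on $M_{t_1}$, and the total slice energy $E_t(\phi+\psi)=E_t(\phi)+E_t(\psi)$ satisfies $$E_{t_1}(\phi+\psi)-E_{t_0}(\phi+\psi)=\int_{M_{t_1}}G^{\alpha\beta}X_\alpha N_\beta\,d\mu_{t_1}-\int_{M_{t_0}}G^{\alpha\beta}X_\alpha N_\beta\,d\mu_{t_0}.$$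 In particular, if $X$ is a Killing field of $g$, the total slice energy is conserved: $E_{t_1}(\phi+\psi)=E_{t_0}(\phi+\psi)$. -/

import Mathlib

open scoped ContDiff Manifold Topology
open MeasureTheory

noncomputable section

namespace SliceEnergy

/-- The model vector space `ℝⁿ × ℝ` of the spacetime `M × ℝ`. -/
abbrev Vec (n : ℕ) : Type := EuclideanSpace ℝ (Fin n) × ℝ

/-- The model with corners (without boundary) of the spacetime `M × ℝ`. -/
abbrev 𝓘st (n : ℕ) :
    ModelWithCorners ℝ (Vec n) (ModelProd (EuclideanSpace ℝ (Fin n)) ℝ) :=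
  (𝓡 n).prod 𝓘(ℝ, ℝ)

/-- Spacetime indices: `Sum.inl i` are the `n` spatial ones, `Sum.inr ()` is the time index. -/
abbrev Idx (n : ℕ) : Type := Fin n ⊕ Unit

/-- The standard basis of `ℝⁿ × ℝ`. -/
def stdVec {n : ℕ} : Idx n → Vec n
  | Sum.inl i => (EuclideanSpace.single i 1, 0)
  | Sum.inr _ => (0, 1)

/-- The standard coordinates on `ℝⁿ × ℝ`. -/
def coord {n : ℕ} : Idx n → Vec n → ℝ
  | Sum.inl i => fun v => v.1 i
  | Sum.inr _ => fun v => v.2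

variable {n : ℕ} {M : Type*} [TopologicalSpace M] [ChartedSpace (EuclideanSpace ℝ (Fin n)) M]

/-! ### Fields on the spacetime `M × ℝ` -/

variable (n M) in
/-- Vector fields on the spacetime. -/
abbrev VField : Type _ := ∀ p : M × ℝ, TangentSpace (𝓘st n) p

variable (n M) in
/-- Tensor fields of type `(0,2)` on the spacetime (all indices lowered). -/
abbrev Tensor2 : Type _ :=
  ∀ p : M × ℝ, TangentSpace (𝓘st n) p →L[ℝ] TangentSpace (𝓘st n) p →L[ℝ] ℝ

/-! In everything below `p₀ : M × ℝ` selects the chart `extChartAt (𝓘st n) p₀` of the spacetime and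
`y : Vec n` is a point of the target of this chart. -/

/-- The coordinate vector field `∂_i` of the chart at `p₀`, at the point with coordinates `y`. -/
def coordVec (p₀ : M × ℝ) (y : Vec n) (i : Idx n) :
    TangentSpace (𝓘st n) ((extChartAt (𝓘st n) p₀).symm y) :=
  mfderiv 𝓘(ℝ, Vec n) (𝓘st n) (extChartAt (𝓘st n) p₀).symm y (stdVec i : Vec n)

/-- Components `A_{ij}` of a `(0,2)` tensor field in the chart at `p₀`. -/
def comp (A : Tensor2 n M) (p₀ : M × ℝ) (y : Vec n) : Matrix (Idx n) (Idx n) ℝ :=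
  Matrix.of fun i j =>
    A ((extChartAt (𝓘st n) p₀).symm y) (coordVec p₀ y i) (coordVec p₀ y j)

/-- Components of a vector field in the chart at `p₀`, as a vector of `ℝⁿ × ℝ`. -/
def compVec (X : VField n M) (p₀ : M × ℝ) (y : Vec n) : Vec n :=
  mfderiv (𝓘st n) 𝓘(ℝ, Vec n) (extChartAt (𝓘st n) p₀) ((extChartAt (𝓘st n) p₀).symm y)
    (X ((extChartAt (𝓘st n) p₀).symm y))

/-- Smoothness of a vector field: its components in the charts of the spacetime are smooth. -/
def VField.Smooth (X : VField n M) : Prop :=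
  ∀ p₀ : M × ℝ, ContDiffOn ℝ ∞ (compVec X p₀) (extChartAt (𝓘st n) p₀).target

/-- Smoothness of a `(0,2)` tensor field: its components in the charts of the spacetime are
smooth. -/
def Tensor2.Smooth (A : Tensor2 n M) : Prop :=
  ∀ (p₀ : M × ℝ) (i j : Idx n),
    ContDiffOn ℝ ∞ (fun y => comp A p₀ y i j) (extChartAt (𝓘st n) p₀).target

/-- Symmetry of a `(0,2)` tensor field. -/
def Tensor2.Symm (A : Tensor2 n M) : Prop :=
  ∀ (p : M × ℝ) (u v : TangentSpace (𝓘st n) p), A p u v = A p v u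

variable (n M) in
/-- Spacetime metrics on `M × ℝ`: smooth metrics of signature `(+,-,…,-)` for which every slice
`M × {t}` is spacelike. -/
structure SpacetimeMetric where
  /-- the metric tensor -/
  val : Tensor2 n M
  symm : val.Symm
  smooth : val.Smooth
  /-- signature `(+,-,…,-)`: there is a timelike vector whose orthogonal complement is
  negative definite -/
  signature : ∀ p : M × ℝ, ∃ u : TangentSpace (𝓘st n) p, 0 < val p u u ∧
    ∀ v : TangentSpace (𝓘st n) p, val p u v = 0 → v ≠ 0 → val p v v < 0
  /-- vectors tangent to the slices are spacelike -/
  spacelike : ∀ (p : M × ℝ) (v : EuclideanSpace ℝ (Fin n)), v ≠ 0 →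
    val p ((v, 0) : Vec n) ((v, 0) : Vec n) < 0

/-! ### Pointwise algebra: raising indices, gradient, unit normal, lapse -/

/-- The inverse Gram matrix of `g` at `p`, in the standard basis of the tangent space. -/
def invGram (g : SpacetimeMetric n M) (p : M × ℝ) : Matrix (Idx n) (Idx n) ℝ :=
  (Matrix.of fun i j => g.val p (stdVec i) (stdVec j))⁻¹

/-- Raising an index: the vector `η^α = g^{αβ} η_β`. -/
def sharp (g : SpacetimeMetric n M) (p : M × ℝ) (η : TangentSpace (𝓘st n) p →L[ℝ] ℝ) :
    TangentSpace (𝓘st n) p :=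
  (∑ i, ∑ j, (invGram g p i j * η (stdVec j)) • stdVec i : Vec n)

/-- The differential `dt` of the time coordinate `t : M × ℝ → ℝ`. -/
def dt (p : M × ℝ) : TangentSpace (𝓘st n) p →L[ℝ] ℝ :=
  mfderiv (𝓘st n) 𝓘(ℝ, ℝ) (fun q : M × ℝ => q.2) p

/-- `g^{αβ} ∂_α t ∂_β t`, which is positive as the slices are spacelike. -/
def gtt (g : SpacetimeMetric n M) (p : M × ℝ) : ℝ := dt p (sharp g p (dt p))

/-- The future-directed unit normal to the slices, `N^α = g^{αβ} ∂_β t / √(g^{tt})`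
(the time orientation is the one for which `t` increases to the future). -/
def unitNormal (g : SpacetimeMetric n M) : VField n M :=
  fun p => (Real.sqrt (gtt g p))⁻¹ • sharp g p (dt p)

/-- The lapse function `1 / √(g^{tt})`; the spacetime volume element is `dμ = lapse dμ_t dt`. -/
def lapse (g : SpacetimeMetric n M) (p : M × ℝ) : ℝ := (Real.sqrt (gtt g p))⁻¹

/-- The vector field `X` is causal (nowhere spacelike). -/
def IsCausal (g : SpacetimeMetric n M) (X : VField n M) : Prop :=
  ∀ p, 0 ≤ g.val p (X p) (X p)

/-! ### The Levi-Civita connection and its curvature, in charts -/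

/-- The contravariant components `g^{ij}` of the metric in the chart at `p₀`. -/
def invMetric (g : SpacetimeMetric n M) (p₀ : M × ℝ) (y : Vec n) : Matrix (Idx n) (Idx n) ℝ :=
  (comp g.val p₀ y)⁻¹

/-- The partial derivative `∂_i f`. -/
def pd (i : Idx n) (f : Vec n → ℝ) (y : Vec n) : ℝ := fderiv ℝ f y (stdVec i)

/-- The Christoffel symbols
`Γ^k_{ij} = ½ g^{kl} (∂_i g_{jl} + ∂_j g_{il} - ∂_l g_{ij})` of the Levi-Civita connection. -/
def Γ (g : SpacetimeMetric n M) (p₀ : M × ℝ) (k i j : Idx n) (y : Vec n) : ℝ :=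
  (1 / 2) * ∑ l, invMetric g p₀ y k l *
    (pd i (fun z => comp g.val p₀ z j l) y + pd j (fun z => comp g.val p₀ z i l) y
      - pd l (fun z => comp g.val p₀ z i j) y)

/-- The Ricci tensor
`R_{ij} = ∂_k Γ^k_{ij} - ∂_j Γ^k_{ik} + Γ^k_{kl} Γ^l_{ij} - Γ^k_{jl} Γ^l_{ik}`. -/
def ricci (g : SpacetimeMetric n M) (p₀ : M × ℝ) (i j : Idx n) (y : Vec n) : ℝ :=
  (∑ k, (pd k (Γ g p₀ k i j) y - pd j (Γ g p₀ k i k) y)) +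
    ∑ k, ∑ l, (Γ g p₀ k k l y * Γ g p₀ l i j y - Γ g p₀ k j l y * Γ g p₀ l i k y)

/-- The scalar curvature `R = g^{ij} R_{ij}`. -/
def scalarCurv (g : SpacetimeMetric n M) (p₀ : M × ℝ) (y : Vec n) : ℝ :=
  ∑ i, ∑ j, invMetric g p₀ y i j * ricci g p₀ i j y

/-- The components `G_{ij} = R_{ij} - ½ R g_{ij}` of the Einstein tensor. -/
def einsteinComp (g : SpacetimeMetric n M) (p₀ : M × ℝ) (i j : Idx n) (y : Vec n) : ℝ :=
  ricci g p₀ i j y - (1 / 2) * scalarCurv g p₀ y * comp g.val p₀ y i j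

/-- The coordinate differential `dx^i` of the chart at `p`, at `p`. -/
def coordDiff (p : M × ℝ) (i : Idx n) (u : TangentSpace (𝓘st n) p) : ℝ :=
  coord i (mfderiv (𝓘st n) 𝓘(ℝ, Vec n) (extChartAt (𝓘st n) p) p u : Vec n)

/-- The Einstein tensor `G = G_{ij} dx^i ⊗ dx^j` at `p`, computed in the chart at `p`. -/
def einstein (g : SpacetimeMetric n M) (p : M × ℝ) (u v : TangentSpace (𝓘st n) p) : ℝ :=
  ∑ i, ∑ j, einsteinComp g p i j (extChartAt (𝓘st n) p p) * coordDiff p i u * coordDiff p j v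

/-- The contravariant components `A^{ij} = g^{ik} g^{jl} A_{kl}` in the chart at `p₀`. -/
def compUp (g : SpacetimeMetric n M) (A : Tensor2 n M) (p₀ : M × ℝ) (i j : Idx n)
    (y : Vec n) : ℝ :=
  ∑ k, ∑ l, invMetric g p₀ y i k * invMetric g p₀ y j l * comp A p₀ y k l

/-- The divergence `∇_i A^{ij} = ∂_i A^{ij} + Γ^i_{il} A^{lj} + Γ^j_{il} A^{il}`. -/
def divergence (g : SpacetimeMetric n M) (A : Tensor2 n M) (p₀ : M × ℝ) (j : Idx n)
    (y : Vec n) : ℝ :=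
  (∑ i, pd i (compUp g A p₀ i j) y) +
    ∑ i, ∑ l, (Γ g p₀ i i l y * compUp g A p₀ l j y + Γ g p₀ j i l y * compUp g A p₀ i l y)

/-- The conservation identity `∇_α A^{αβ} = 0`, in the charts of the spacetime. -/
def IsConserved (g : SpacetimeMetric n M) (A : Tensor2 n M) : Prop :=
  ∀ (p₀ : M × ℝ), ∀ y ∈ (extChartAt (𝓘st n) p₀).target, ∀ j, divergence g A p₀ j y = 0

/-- The covariant components `X_j = g_{jk} X^k` of a vector field in the chart at `p₀`. -/
def lowered (g : SpacetimeMetric n M) (X : VField n M) (p₀ : M × ℝ) (j : Idx n)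
    (y : Vec n) : ℝ :=
  g.val ((extChartAt (𝓘st n) p₀).symm y) (X ((extChartAt (𝓘st n) p₀).symm y)) (coordVec p₀ y j)

/-- The covariant derivative `∇_i X_j = ∂_i X_j - Γ^k_{ij} X_k`. -/
def covDeriv (g : SpacetimeMetric n M) (X : VField n M) (p₀ : M × ℝ) (i j : Idx n)
    (y : Vec n) : ℝ :=
  pd i (lowered g X p₀ j) y - ∑ k, Γ g p₀ k i j y * lowered g X p₀ k y

/-- `X` is a Killing field of `g`: `∇_α X_β + ∇_β X_α = 0`, in the charts of the spacetime. -/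
def IsKilling (g : SpacetimeMetric n M) (X : VField n M) : Prop :=
  ∀ (p₀ : M × ℝ), ∀ y ∈ (extChartAt (𝓘st n) p₀).target, ∀ i j,
    covDeriv g X p₀ i j y + covDeriv g X p₀ j i y = 0

/-! ### The stress tensor of a scalar field -/

/-- The differential of a scalar field. -/
def dScalar (φ : M × ℝ → ℝ) (p : M × ℝ) : TangentSpace (𝓘st n) p →L[ℝ] ℝ :=
  mfderiv (𝓘st n) 𝓘(ℝ, ℝ) φ p

/-- The stress tensor of the scalar field `φ` with potential `V`:
`T_{αβ}(φ) = ∂_α φ ∂_β φ - ½ g_{αβ} (∂^λ φ ∂_λ φ - 2 V(φ))`. -/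
def scalarStress (g : SpacetimeMetric n M) (V : ℝ → ℝ) (φ : M × ℝ → ℝ) : Tensor2 n M :=
  fun p => (dScalar φ p).smulRight (dScalar φ p) -
    ((1 / 2) * (dScalar φ p (sharp g p (dScalar φ p)) - 2 * V (φ p))) • g.val p

/-! ### The volume of the slices -/

/-- The components `h_{ij}` of the spatial metric `g_t = -g|_{M × {t}}` (positive definite) in
the chart of `M` at `m₀`, at the point with coordinates `y`. -/
def spatialComp (g : SpacetimeMetric n M) (t : ℝ) (m₀ : M) (y : EuclideanSpace ℝ (Fin n)) :
    Matrix (Fin n) (Fin n) ℝ :=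
  let m : M := (extChartAt (𝓡 n) m₀).symm y
  let e : Fin n → EuclideanSpace ℝ (Fin n) := fun i =>
    mfderiv 𝓘(ℝ, EuclideanSpace ℝ (Fin n)) (𝓡 n) (extChartAt (𝓡 n) m₀).symm y
      (EuclideanSpace.single i (1 : ℝ) : EuclideanSpace ℝ (Fin n))
  Matrix.of fun i j => - g.val (m, t) ((e i, 0) : Vec n) ((e j, 0) : Vec n)

/-- The volume measure `√(det h) dx¹ ⋯ dxⁿ` on the domain of the chart of `M` at `m₀`. -/
def chartVolume [MeasurableSpace M] (g : SpacetimeMetric n M) (t : ℝ) (m₀ : M) : Measure M :=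
  (((volume : Measure (EuclideanSpace ℝ (Fin n))).restrict
      (extChartAt (𝓡 n) m₀).target).withDensity
    (fun y => ENNReal.ofReal (Real.sqrt (spatialComp g t m₀ y).det))).map
      (extChartAt (𝓡 n) m₀).symm

/-- The volume measure `dμ_t` of the slice `M × {t}`: the least measure that dominates the volume
measures of all chart domains. As the latter agree on overlaps, it restricts to
`√(det h) dx¹ ⋯ dxⁿ` on each chart domain. -/
def sliceVolume [MeasurableSpace M] (g : SpacetimeMetric n M) (t : ℝ) : Measure M :=
  ⨆ m₀ : M, chartVolume g t m₀

/-! ### Slice energy -/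

/-- The energy-momentum vector `P^β = X_α T^{αβ}` of `T` relative to `X`. -/
def energyMomentum (g : SpacetimeMetric n M) (X : VField n M) (T : Tensor2 n M) : VField n M :=
  fun p => sharp g p (T p (X p))

/-- The energy density `P^α n_α` on the slice `M × {t}`. -/
def energyDensity (g : SpacetimeMetric n M) (X : VField n M) (T : Tensor2 n M) (t : ℝ)
    (m : M) : ℝ :=
  g.val (m, t) (energyMomentum g X T (m, t)) (unitNormal g (m, t))

/-- The slice energy `E_t = ∫_{M_t} P^α n_α dμ_t`. -/
def sliceEnergy [MeasurableSpace M] (g : SpacetimeMetric n M) (X : VField n M)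
    (T : Tensor2 n M) (t : ℝ) : ℝ :=
  ∫ m, energyDensity g X T t m ∂(sliceVolume g t)

/-- The total slice energy `E_t(φ + ψ) = E_t(φ) + E_t(ψ)` of two fields with stress tensors
`Tφ` and `Tψ`. -/
def totalSliceEnergy [MeasurableSpace M] (g : SpacetimeMetric n M) (X : VField n M)
    (Tφ Tψ : Tensor2 n M) (t : ℝ) : ℝ :=
  sliceEnergy g X Tφ t + sliceEnergy g X Tψ t

/-- The density `G^{αβ} X_α N_β` on the slice `M × {t}`. -/
def fluxDensity (g : SpacetimeMetric n M) (X : VField n M) (t : ℝ) (m : M) : ℝ :=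
  einstein g (m, t) (X (m, t)) (unitNormal g (m, t))

/-- The gravitational flux `∫_{M_t} G^{αβ} X_α N_β dμ_t`. -/
def gravFlux [MeasurableSpace M] (g : SpacetimeMetric n M) (X : VField n M) (t : ℝ) : ℝ :=
  ∫ m, fluxDensity g X t m ∂(sliceVolume g t)

/-- Fall-off at spatial infinity, on the slab between `t₀` and `t₁`, of a field with stress tensor
`T`: the energies on the two end slices exist, and for some smooth function `r` on `M` that tends
to infinity at infinity the `r`-component `P^α ∂_α r` of the energy-momentum vector is absolutely
integrable over the slab with respect to the spacetime volume `dμ = lapse dμ_t dt`. -/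
def FallOff [MeasurableSpace M] (g : SpacetimeMetric n M) (X : VField n M)
    (T : Tensor2 n M) (t₀ t₁ : ℝ) : Prop :=
  Integrable (energyDensity g X T t₀) (sliceVolume g t₀) ∧
  Integrable (energyDensity g X T t₁) (sliceVolume g t₁) ∧
  ∃ r : M → ℝ, ContMDiff (𝓡 n) 𝓘(ℝ, ℝ) ∞ r ∧ Filter.Tendsto r (Filter.cocompact M) Filter.atTop ∧
    ∫⁻ t in Set.Icc t₀ t₁, ∫⁻ m, ENNReal.ofReal (lapse g (m, t) *
      |dScalar (n := n) (fun q : M × ℝ => r q.1) (m, t) (energyMomentum g X T (m, t))|)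
        ∂(sliceVolume g t) < ⊤

end SliceEnergy

end

/-! The flux identity is pointwise. Since `P` is `T(X, ·)` with its index raised, the energy density
of a field is `T(X, N)`, so contracting the Einstein equations with `X` and `N` gives `G(X, N)` as
the sum of the two energy densities (`fluxDensity_eq_add`). Once the densities are integrable, total
slice energy and gravitational flux agree on each end slice.

For a Killing field each of the two energies is conserved separately. As `∇_α T^{αβ} = 0` and `T` is
symmetric, `∇_α P^α = T^{αβ} ∇_α X_β = 0`; in a chart this reads `∂_i (√|det g| P^i) = 0`
(`sum_pd_volDensity_mul_energyMomentumComp`). Testing against a compactly supported function `f` on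
`M` shows that the change of `∫ f P^α N_α dμ_t` from `t₀` to `t₁` is the integral of `P^α ∂_α f`
over the slab: `integral_continuity_equation` in coordinates, and
`integralBalance_of_hasCompactSupport` on `M` by a partition of unity. The passage between slices
and coordinates rests on `lapse · √det h = √|det g|` (`lapse_mul_sqrt_det_spatialComp`) and on the
compatibility of the chart volumes (`sliceVolume_restrict_source`).

If `M` is compact, take `f = 1`. Under fall-off, take `f` to be a cutoff of `r / (k + 1)`: the slab
term is at most a constant times `1 / (k + 1)`, and the slice terms tend to the energies by
dominated convergence. -/

noncomputable section

namespace SliceEnergy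

variable {n : ℕ} {M : Type*} [TopologicalSpace M] [ChartedSpace (EuclideanSpace ℝ (Fin n)) M]

/-! ### Nondegenerate bilinear forms: raising an index in an arbitrary basis. -/

section BilinearForms

variable {ι W : Type*} [Fintype ι] [DecidableEq ι] [AddCommGroup W] [Module ℝ W]
  [TopologicalSpace W]

/-- The Gram matrix of a bilinear form in a basis. -/
def gram (B : W →L[ℝ] W →L[ℝ] ℝ) (b : Module.Basis ι ℝ W) : Matrix ι ι ℝ :=
  Matrix.of fun i j => B (b i) (b j)

/-- The vector dual to a covector with respect to a bilinear form, computed in a basis. -/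
def raise (B : W →L[ℝ] W →L[ℝ] ℝ) (b : Module.Basis ι ℝ W) (η : W →L[ℝ] ℝ) : W :=
  ∑ i, ∑ j, ((gram B b)⁻¹ i j * η (b j)) • b i

variable {B : W →L[ℝ] W →L[ℝ] ℝ}

omit [Fintype ι] [DecidableEq ι] in
theorem gram_isSymm (hs : ∀ u v, B u v = B v u) (b : Module.Basis ι ℝ W) :
    (gram B b).IsSymm := by
  ext i j
  simp [gram, hs (b i) (b j)]

/-- A kernel vector `c` of the Gram matrix yields a combination `∑ c j • b j` orthogonal to every
basis vector. Nondegeneracy makes it zero, against the independence of `b`. -/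
theorem gram_det_ne_zero (hs : ∀ u v, B u v = B v u) (hn : ∀ w, (∀ v, B w v = 0) → w = 0)
    (b : Module.Basis ι ℝ W) : (gram B b).det ≠ 0 := by
  intro h
  obtain ⟨c, hc, hc'⟩ := Matrix.exists_mulVec_eq_zero_iff.2 h
  apply hc
  have h0 : ∑ j, c j • b j = 0 := by
    apply hn
    intro v
    rw [hs]
    have h1 : ∀ i, B (b i) (∑ j, c j • b j) = 0 := by
      intro i
      have := congrFun hc' i
      simp only [Matrix.mulVec, dotProduct, gram, Matrix.of_apply, Pi.zero_apply] at this
      rw [← this, map_sum]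
      exact Finset.sum_congr rfl fun j _ => by rw [map_smul, smul_eq_mul, mul_comm]
    rw [← b.sum_repr v, map_sum B, sum_apply]
    exact Finset.sum_eq_zero fun i _ => by rw [map_smul, smul_apply, h1, smul_zero]
  exact funext (Fintype.linearIndependent_iff.1 b.linearIndependent c h0)

theorem apply_raise (hs : ∀ u v, B u v = B v u) (hn : ∀ w, (∀ v, B w v = 0) → w = 0)
    (b : Module.Basis ι ℝ W) (η : W →L[ℝ] ℝ) (v : W) : B (raise B b η) v = η v := by
  have hd := gram_det_ne_zero hs hn b
  have key : ∀ k, B (raise B b η) (b k) = η (b k) := by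
    intro k
    -- `raise` leads to a sum over the first index of the inverse, matrix multiplication to one over
    -- the second; symmetry reconciles them.
    have hsi : (gram B b)⁻¹.transpose = (gram B b)⁻¹ := by
      rw [Matrix.transpose_nonsing_inv, gram_isSymm hs b]
    have e1 : ∀ j, ∑ i, (gram B b)⁻¹ i j * B (b i) (b k) = if j = k then 1 else 0 := by
      intro j
      have := congrFun (congrFun (Matrix.nonsing_inv_mul (gram B b) (Ne.isUnit hd)) j) k
      rw [Matrix.mul_apply, Matrix.one_apply] at this
      rw [← this]
      refine Finset.sum_congr rfl fun i _ => ?_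
      rw [← Matrix.transpose_apply (gram B b)⁻¹ j i, hsi]
      rfl
    simp only [raise, map_sum, sum_apply, map_smul,
      smul_apply, smul_eq_mul]
    rw [Finset.sum_comm]
    calc ∑ j, ∑ i, (gram B b)⁻¹ i j * η (b j) * B (b i) (b k)
        = ∑ j, η (b j) * ∑ i, (gram B b)⁻¹ i j * B (b i) (b k) := by
          refine Finset.sum_congr rfl fun j _ => ?_
          rw [Finset.mul_sum]
          exact Finset.sum_congr rfl fun i _ => by ring
      _ = η (b k) := by simp [e1]
  rw [← b.sum_repr v, map_sum, map_sum]
  exact Finset.sum_congr rfl fun i _ => by rw [map_smul, map_smul, key]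

/-- Nondegeneracy makes the dual vector unique, so `raise` is independent of the basis. This lets
`sharp`, defined in the standard basis, be computed in coordinate bases. -/
theorem eq_raise (hs : ∀ u v, B u v = B v u) (hn : ∀ w, (∀ v, B w v = 0) → w = 0)
    (b : Module.Basis ι ℝ W) {η : W →L[ℝ] ℝ} {w : W} (h : ∀ v, B w v = η v) :
    w = raise B b η := by
  rw [← sub_eq_zero]
  apply hn
  intro v
  rw [map_sub, sub_apply, h, apply_raise hs hn, sub_self]

end BilinearForms

/-! ### Symmetry of metric components and of the scalar stress tensor. -/

section Symmetry

variable (g : SpacetimeMetric n M)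

theorem comp_symm {A : Tensor2 n M} (hA : A.Symm) (p₀ : M × ℝ) (y : Vec n) (i j : Idx n) :
    comp A p₀ y i j = comp A p₀ y j i := hA _ _ _

theorem invMetric_symm (p₀ : M × ℝ) (y : Vec n) (i j : Idx n) :
    invMetric g p₀ y i j = invMetric g p₀ y j i := by
  have : (comp g.val p₀ y).transpose = comp g.val p₀ y := by
    ext i j
    exact comp_symm g.symm p₀ y j i
  rw [invMetric, ← Matrix.transpose_apply (comp g.val p₀ y)⁻¹, Matrix.transpose_nonsing_inv, this]

theorem scalarStress_symm (V : ℝ → ℝ) (φ : M × ℝ → ℝ) : (scalarStress g V φ).Symm := by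
  intro p u v
  simp only [scalarStress, sub_apply, smul_apply, ContinuousLinearMap.smulRight_apply, smul_eq_mul,
    g.symm p u v]
  ring

end Symmetry

/-! ### Pointwise Lorentzian algebra: lapse, unit normal, energy density. -/

section Pointwise

variable (g : SpacetimeMetric n M) (p : M × ℝ)

variable (n) in
/-- The standard basis of `ℝⁿ × ℝ`. -/
def stdBasis : Module.Basis (Idx n) ℝ (Vec n) :=
  (EuclideanSpace.basisFun (Fin n) ℝ).toBasis.prod (Module.Basis.singleton Unit ℝ)

theorem stdBasis_apply (i : Idx n) : stdBasis n i = stdVec i := by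
  rcases i with i | i
  · simp [stdBasis, stdVec, EuclideanSpace.basisFun_apply]
  · simp [stdBasis, stdVec]

theorem stdBasis_repr (v : Vec n) (i : Idx n) : (stdBasis n).repr v i = coord i v := by
  rcases i with i | i
  · simp [stdBasis, coord]
  · simp [stdBasis, coord]

/-- The standard basis of a tangent space of the spacetime. -/
def tangentBasis : Module.Basis (Idx n) ℝ (TangentSpace (𝓘st n) p) := stdBasis n

theorem tangentBasis_apply (i : Idx n) : tangentBasis p i = (stdVec i : Vec n) := stdBasis_apply i

/-- A nonzero `w` orthogonal to everything is in particular orthogonal to the timelike vector of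
`signature`, so `g(w, w) < 0`, whereas `g(w, w) = 0`. -/
theorem SpacetimeMetric.nondegenerate (w : TangentSpace (𝓘st n) p)
    (h : ∀ v, g.val p w v = 0) : w = 0 := by
  obtain ⟨u, -, hu⟩ := g.signature p
  by_contra hw
  have := hu w (by rw [g.symm, h]) hw
  rw [h] at this
  exact lt_irrefl _ this

theorem sharp_eq_raise_std (η : TangentSpace (𝓘st n) p →L[ℝ] ℝ) :
    sharp g p η = raise (g.val p) (tangentBasis p) η := by
  have hg : (Matrix.of fun i j => g.val p (stdVec i : Vec n) (stdVec j : Vec n)) =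
      gram (g.val p) (tangentBasis p) := by
    ext i j
    simp only [Matrix.of_apply, gram, tangentBasis_apply]
  have hg' : invGram g p = (gram (g.val p) (tangentBasis p))⁻¹ := by
    rw [← hg]
    rfl
  rw [raise, ← hg']
  simp only [tangentBasis_apply]
  rfl

theorem val_sharp (η : TangentSpace (𝓘st n) p →L[ℝ] ℝ) (v : TangentSpace (𝓘st n) p) :
    g.val p (sharp g p η) v = η v := by
  rw [sharp_eq_raise_std]
  exact apply_raise (g.symm p) (g.nondegenerate p) _ _ _

theorem sharp_eq_raise (b : Module.Basis (Idx n) ℝ (TangentSpace (𝓘st n) p))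
    (η : TangentSpace (𝓘st n) p →L[ℝ] ℝ) : sharp g p η = raise (g.val p) b η :=
  eq_raise (g.symm p) (g.nondegenerate p) b (val_sharp g p η)

theorem dt_apply (v : TangentSpace (𝓘st n) p) : dt p v = (v : Vec n).2 := by
  have : dt (n := n) p = ContinuousLinearMap.snd ℝ (EuclideanSpace ℝ (Fin n)) ℝ :=
    mfderiv_snd
  rw [this]
  rfl

/-- The vector `w` dual to `dt` is orthogonal to the slice, and `g(w, w) = dt(w) = g^{tt}`. If this
were zero, `w` would be tangent to the slice and null, hence zero, against `dt ≠ 0`. If it were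
negative, splitting a timelike `u` into a slice vector and a multiple of `w` would give `g(u, u) ≤
0`. -/
theorem gtt_pos : 0 < gtt g p := by
  set w := sharp g p (dt p) with hw
  have h1 : ∀ v, g.val p w v = (v : Vec n).2 := fun v => by rw [hw, val_sharp, dt_apply]
  have h2 : gtt g p = (w : Vec n).2 := by rw [gtt, ← hw, dt_apply]
  have h3 : gtt g p = g.val p w w := by rw [h1, h2]
  have hsp : ∀ v : TangentSpace (𝓘st n) p, (v : Vec n).2 = 0 → g.val p v v ≤ 0 := by
    intro v hv
    by_cases h : (v : Vec n).1 = 0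
    · have : v = 0 := Prod.ext h hv
      rw [this, map_zero]
    · have := (g.spacelike p (v : Vec n).1 h).le
      rwa [show (((v : Vec n).1, (0 : ℝ)) : Vec n) = v from Prod.ext rfl hv.symm] at this
  have hne : gtt g p ≠ 0 := by
    intro h0
    have hw2 : (w : Vec n).2 = 0 := by rw [← h2, h0]
    have hw1 : (w : Vec n).1 = 0 := by
      by_contra hc
      have := g.spacelike p (w : Vec n).1 hc
      rw [show (((w : Vec n).1, (0 : ℝ)) : Vec n) = w from Prod.ext rfl hw2.symm] at this
      have h4 : g.val p w w = 0 := by rw [← h3, h0]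
      exact absurd h4 this.ne
    have hw0 : w = 0 := Prod.ext hw1 hw2
    have := h1 ((0, 1) : Vec n)
    rw [hw0, map_zero] at this
    exact zero_ne_one this
  by_contra hcon
  have hneg : gtt g p < 0 := lt_of_le_of_ne (not_lt.1 hcon) hne
  obtain ⟨u, hu, -⟩ := g.signature p
  -- Since `dt(w) = g^{tt}`, this is the coefficient for which `u - c • w` is tangent to the slice.
  set c : ℝ := (u : Vec n).2 / gtt g p with hc
  set v : TangentSpace (𝓘st n) p := u - c • w with hv
  have hv2 : (v : Vec n).2 = 0 := by
    have : (v : Vec n).2 = (u : Vec n).2 - c * (w : Vec n).2 := rfl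
    rw [this, ← h2, hc]
    field_simp
    ring
  have hu' : u = v + c • w := by rw [hv]; abel
  have hwv : g.val p w v = 0 := by rw [h1, hv2]
  have hvw : g.val p v w = 0 := by rw [g.symm, hwv]
  have : g.val p u u = g.val p v v + c * c * g.val p w w := by
    rw [hu']
    simp only [map_add, map_smul, add_apply, smul_apply,
      smul_eq_mul, hwv, hvw]
    ring
  have h5 := hsp v hv2
  rw [← h3] at this
  nlinarith [mul_self_nonneg c]

theorem lapse_pos : 0 < lapse g p := inv_pos.2 (Real.sqrt_pos.2 (gtt_pos g p))

/-- Lowered, the unit normal is `lapse · dt`: the normalising factor `1 / √g^{tt}` of `N` is the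
lapse. The energy density is therefore `lapse · P^t`. -/
theorem val_unitNormal (v : TangentSpace (𝓘st n) p) :
    g.val p v (unitNormal g p) = lapse g p * (v : Vec n).2 := by
  rw [g.symm, unitNormal, map_smul, smul_apply, val_sharp, dt_apply]
  rfl

theorem val_energyMomentum (X : VField n M) (T : Tensor2 n M) (v : TangentSpace (𝓘st n) p) :
    g.val p (energyMomentum g X T p) v = T p (X p) v := val_sharp g p _ _

theorem energyDensity_eq_lapse_mul (X : VField n M) (T : Tensor2 n M) (t : ℝ) (m : M) :
    energyDensity g X T t m = lapse g (m, t) * (energyMomentum g X T (m, t) : Vec n).2 :=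
  val_unitNormal g _ _

theorem energyDensity_eq_apply (X : VField n M) (T : Tensor2 n M) (t : ℝ) (m : M) :
    energyDensity g X T t m = T (m, t) (X (m, t)) (unitNormal g (m, t)) :=
  val_energyMomentum g _ X T _

/-- `det A = g^{tt} det g` in a basis that is adapted to the slices. -/
theorem det_spatial_block (b : Module.Basis (Idx n) ℝ (TangentSpace (𝓘st n) p))
    (hl : ∀ i, (b (Sum.inl i) : Vec n).2 = 0) (hr : (b (Sum.inr ()) : Vec n).2 = 1) :
    (gram (g.val p) b).toBlocks₁₁.det = gtt g p * (gram (g.val p) b).det := by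
  have hd := gram_det_ne_zero (g.symm p) (g.nondegenerate p) b
  -- In an adapted basis `dt` has components `(0, …, 0, 1)`, so `g^{tt}` is the time-time entry of
  -- the inverse Gram matrix, which Cramer's rule writes as a cofactor over the determinant.
  have h1 : gtt g p = (gram (g.val p) b)⁻¹ (Sum.inr ()) (Sum.inr ()) := by
    rw [gtt, sharp_eq_raise g p b, raise, map_sum]
    simp [dt_apply, hl, hr]
  rw [h1, Matrix.inv_def, Matrix.smul_apply, Ring.inverse_eq_inv', smul_eq_mul,
    Matrix.adjugate_apply]
  -- The matrix of this cofactor is block triangular with diagonal blocks the spatial block and `1`.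
  have h2 : (gram (g.val p) b).updateRow (Sum.inr ()) (Pi.single (Sum.inr ()) 1)
      = Matrix.fromBlocks (gram (g.val p) b).toBlocks₁₁ (gram (g.val p) b).toBlocks₁₂ 0 1 := by
    ext i j
    rcases i with i | i <;> rcases j with j | j <;>
      simp [Matrix.updateRow_apply, Matrix.toBlocks₁₁, Matrix.toBlocks₁₂]
  rw [h2, Matrix.det_fromBlocks_zero₂₁, Matrix.det_one, mul_one]
  field_simp

end Pointwise

/-! ### Tensor components in the charts of the spacetime. -/

section Charts

variable [IsManifold (𝓡 n) ∞ M] (g : SpacetimeMetric n M) (p₀ : M × ℝ) {y : Vec n}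

/-- The derivative of the inverse of a chart of the spacetime, as a linear equivalence. -/
def chartEquiv (hy : y ∈ (extChartAt (𝓘st n) p₀).target) :
    Vec n ≃ₗ[ℝ] TangentSpace (𝓘st n) ((extChartAt (𝓘st n) p₀).symm y) :=
  haveI : IsManifold (𝓘st n) 1 (M × ℝ) := .of_le (n := ∞) (by simp)
  LinearEquiv.ofLinearMap
    (mfderiv 𝓘(ℝ, Vec n) (𝓘st n) (extChartAt (𝓘st n) p₀).symm y).toLinearMap
    (mfderiv (𝓘st n) 𝓘(ℝ, Vec n) (extChartAt (𝓘st n) p₀)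
      ((extChartAt (𝓘st n) p₀).symm y)).toLinearMap
    (by
      have := mfderivWithin_extChartAt_symm_comp_mfderiv_extChartAt hy
      rw [ModelWithCorners.range_eq_univ, mfderivWithin_univ] at this
      exact congrArg ContinuousLinearMap.toLinearMap this)
    (by
      have := mfderiv_extChartAt_comp_mfderivWithin_extChartAt_symm hy
      rw [ModelWithCorners.range_eq_univ, mfderivWithin_univ] at this
      exact congrArg ContinuousLinearMap.toLinearMap this)

/-- The coordinate vector fields as a basis of the tangent space. -/
def chartBasis (hy : y ∈ (extChartAt (𝓘st n) p₀).target) :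
    Module.Basis (Idx n) ℝ (TangentSpace (𝓘st n) ((extChartAt (𝓘st n) p₀).symm y)) :=
  (stdBasis n).map (chartEquiv p₀ hy)

variable {p₀}

theorem chartBasis_apply (hy : y ∈ (extChartAt (𝓘st n) p₀).target) (i : Idx n) :
    chartBasis p₀ hy i = coordVec p₀ y i := by
  rw [chartBasis, Module.Basis.map_apply, stdBasis_apply]
  rfl

theorem sum_compVec_smul_coordVec (hy : y ∈ (extChartAt (𝓘st n) p₀).target) (X : VField n M) :
    X ((extChartAt (𝓘st n) p₀).symm y) = ∑ i, coord i (compVec X p₀ y) • coordVec p₀ y i := by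
  rw [← (chartBasis p₀ hy).sum_repr (X ((extChartAt (𝓘st n) p₀).symm y))]
  refine Finset.sum_congr rfl fun i _ => ?_
  rw [chartBasis_apply, chartBasis, Module.Basis.map_repr, LinearEquiv.trans_apply, stdBasis_repr]
  rfl

theorem gram_chartBasis (hy : y ∈ (extChartAt (𝓘st n) p₀).target) :
    gram (g.val ((extChartAt (𝓘st n) p₀).symm y)) (chartBasis p₀ hy) = comp g.val p₀ y := by
  ext i j
  simp only [gram, comp, Matrix.of_apply, chartBasis_apply]

theorem comp_val_det_ne_zero (hy : y ∈ (extChartAt (𝓘st n) p₀).target) :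
    (comp g.val p₀ y).det ≠ 0 := by
  rw [← gram_chartBasis g hy]
  exact gram_det_ne_zero (g.symm _) (g.nondegenerate _) _

theorem sharp_eq_sum (hy : y ∈ (extChartAt (𝓘st n) p₀).target)
    (η : TangentSpace (𝓘st n) ((extChartAt (𝓘st n) p₀).symm y) →L[ℝ] ℝ) :
    sharp g ((extChartAt (𝓘st n) p₀).symm y) η =
      ∑ i, (∑ j, invMetric g p₀ y i j * η (coordVec p₀ y j)) • coordVec p₀ y i := by
  rw [sharp_eq_raise g _ (chartBasis p₀ hy), raise, gram_chartBasis]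
  simp only [chartBasis_apply, Finset.sum_smul]
  rfl

theorem sum_invMetric_mul (hy : y ∈ (extChartAt (𝓘st n) p₀).target) (i j : Idx n) :
    ∑ k, invMetric g p₀ y i k * comp g.val p₀ y k j = if i = j then 1 else 0 := by
  have := Matrix.nonsing_inv_mul (comp g.val p₀ y) (comp_val_det_ne_zero g hy).isUnit
  rw [← Matrix.one_apply, ← this, Matrix.mul_apply]
  rfl

theorem lowered_eq_sum (hy : y ∈ (extChartAt (𝓘st n) p₀).target) (X : VField n M) (j : Idx n) :
    lowered g X p₀ j y = ∑ k, coord k (compVec X p₀ y) * comp g.val p₀ y k j := by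
  rw [lowered, sum_compVec_smul_coordVec hy X, map_sum, sum_apply]
  exact Finset.sum_congr rfl fun i _ => by rw [map_smul]; rfl

theorem sum_invMetric_mul_lowered (hy : y ∈ (extChartAt (𝓘st n) p₀).target) (X : VField n M)
    (l : Idx n) :
    ∑ j, invMetric g p₀ y j l * lowered g X p₀ j y = coord l (compVec X p₀ y) := by
  simp only [lowered_eq_sum g hy, Finset.mul_sum]
  rw [Finset.sum_comm]
  have : ∀ k, ∑ j, invMetric g p₀ y j l * (coord k (compVec X p₀ y) * comp g.val p₀ y k j) =
      coord k (compVec X p₀ y) * if l = k then 1 else 0 := by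
    intro k
    rw [← sum_invMetric_mul g hy l k, Finset.mul_sum]
    refine Finset.sum_congr rfl fun j _ => ?_
    rw [invMetric_symm g p₀ y j l, comp_symm g.symm p₀ y k j]
    ring
  simp [this]

/-- The components `P^i = T^{ij} X_j` of the energy-momentum vector. -/
def energyMomentumComp (g : SpacetimeMetric n M) (X : VField n M) (T : Tensor2 n M) (p₀ : M × ℝ)
    (i : Idx n) (y : Vec n) : ℝ :=
  ∑ j, compUp g T p₀ i j y * lowered g X p₀ j y

theorem energyMomentum_eq_sum (hy : y ∈ (extChartAt (𝓘st n) p₀).target) (X : VField n M)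
    {T : Tensor2 n M} (hT : T.Symm) :
    energyMomentum g X T ((extChartAt (𝓘st n) p₀).symm y) =
      ∑ i, energyMomentumComp g X T p₀ i y • coordVec p₀ y i := by
  rw [energyMomentum, sharp_eq_sum g hy]
  refine Finset.sum_congr rfl fun i _ => ?_
  congr 1
  -- The field `X` sits in the first slot of `T`; symmetry moves it to the second index, which
  -- `energyMomentumComp` contracts.
  have h1 : ∀ k, T ((extChartAt (𝓘st n) p₀).symm y) (X ((extChartAt (𝓘st n) p₀).symm y))
      (coordVec p₀ y k) = ∑ l, coord l (compVec X p₀ y) * comp T p₀ y k l := by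
    intro k
    rw [sum_compVec_smul_coordVec hy X, map_sum, sum_apply]
    refine Finset.sum_congr rfl fun l _ => ?_
    rw [map_smul, comp_symm hT]
    rfl
  simp only [h1, energyMomentumComp, compUp, ← sum_invMetric_mul_lowered g hy X, Finset.mul_sum,
    Finset.sum_mul]
  rw [Finset.sum_comm_cycle]
  refine Finset.sum_congr rfl fun j _ => Finset.sum_congr rfl fun k _ =>
    Finset.sum_congr rfl fun l _ => ?_
  rw [invMetric_symm g p₀ y j l]
  ring

end Charts

/-! ### Smoothness of the components. -/

section Smoothness

theorem contDiffOn_det {ι E : Type*} [Fintype ι] [DecidableEq ι] [NormedAddCommGroup E]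
    [NormedSpace ℝ E] {s : Set E} {k : WithTop ℕ∞} {A : E → Matrix ι ι ℝ}
    (hA : ∀ i j, ContDiffOn ℝ k (fun y => A y i j) s) : ContDiffOn ℝ k (fun y => (A y).det) s := by
  simp only [Matrix.det_apply]
  refine ContDiffOn.sum fun σ _ => ?_
  exact (contDiffOn_prod fun i _ => hA _ _).const_smul (Equiv.Perm.sign σ : ℤˣ)

theorem contDiffOn_inv_apply {ι E : Type*} [Fintype ι] [DecidableEq ι] [NormedAddCommGroup E]
    [NormedSpace ℝ E] {s : Set E} {k : WithTop ℕ∞} {A : E → Matrix ι ι ℝ}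
    (hA : ∀ i j, ContDiffOn ℝ k (fun y => A y i j) s) (h0 : ∀ y ∈ s, (A y).det ≠ 0) (i j : ι) :
    ContDiffOn ℝ k (fun y => (A y)⁻¹ i j) s := by
  simp only [Matrix.inv_def, Matrix.smul_apply, Ring.inverse_eq_inv', smul_eq_mul,
    Matrix.adjugate_apply]
  refine ((contDiffOn_det hA).inv h0).mul (contDiffOn_det fun a b => ?_)
  simp only [Matrix.updateRow_apply]
  split_ifs
  · exact contDiffOn_const
  · exact hA a b

variable [IsManifold (𝓡 n) ∞ M] (g : SpacetimeMetric n M) (p₀ : M × ℝ)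

theorem contDiffOn_coord {f : Vec n → Vec n} {s : Set (Vec n)} {k : WithTop ℕ∞}
    (hf : ContDiffOn ℝ k f s) (i : Idx n) : ContDiffOn ℝ k (fun y => coord i (f y)) s := by
  rcases i with i | i
  · exact (EuclideanSpace.proj (𝕜 := ℝ) i).contDiff.comp_contDiffOn hf.fst
  · exact hf.snd

theorem contDiffOn_pd {f : Vec n → ℝ} {s : Set (Vec n)} (hs : IsOpen s)
    (hf : ContDiffOn ℝ ∞ f s) (i : Idx n) : ContDiffOn ℝ ∞ (pd i f) s :=
  (hf.fderiv_of_isOpen hs (by simp)).clm_apply contDiffOn_const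

theorem contDiffOn_invMetric (i j : Idx n) :
    ContDiffOn ℝ ∞ (fun y => invMetric g p₀ y i j) (extChartAt (𝓘st n) p₀).target :=
  contDiffOn_inv_apply (fun i j => g.smooth p₀ i j) (fun _ hy => comp_val_det_ne_zero g hy) i j

theorem contDiffOn_lowered {X : VField n M} (hX : X.Smooth) (j : Idx n) :
    ContDiffOn ℝ ∞ (lowered g X p₀ j) (extChartAt (𝓘st n) p₀).target := by
  refine ContDiffOn.congr (f := fun y => ∑ k, coord k (compVec X p₀ y) * comp g.val p₀ y k j)
    (ContDiffOn.sum fun k _ => (contDiffOn_coord (hX p₀) k).mul (g.smooth p₀ k j)) ?_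
  exact fun y hy => lowered_eq_sum g hy X j

theorem contDiffOn_compUp {T : Tensor2 n M} (hT : T.Smooth) (i j : Idx n) :
    ContDiffOn ℝ ∞ (compUp g T p₀ i j) (extChartAt (𝓘st n) p₀).target :=
  ContDiffOn.sum fun k _ => ContDiffOn.sum fun l _ =>
    ((contDiffOn_invMetric g p₀ i k).mul (contDiffOn_invMetric g p₀ j l)).mul (hT p₀ k l)

theorem contDiffOn_energyMomentumComp {X : VField n M} (hX : X.Smooth) {T : Tensor2 n M}
    (hT : T.Smooth) (i : Idx n) :
    ContDiffOn ℝ ∞ (energyMomentumComp g X T p₀ i) (extChartAt (𝓘st n) p₀).target :=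
  ContDiffOn.sum fun j _ => (contDiffOn_compUp g p₀ hT i j).mul (contDiffOn_lowered g p₀ hX j)

variable {φ : M × ℝ → ℝ}

theorem contDiffOn_comp_symm (hφ : ContMDiff (𝓘st n) 𝓘(ℝ, ℝ) ∞ φ) :
    ContDiffOn ℝ ∞ (φ ∘ (extChartAt (𝓘st n) p₀).symm) (extChartAt (𝓘st n) p₀).target := by
  rw [← contMDiffOn_iff_contDiffOn]
  exact hφ.comp_contMDiffOn (contMDiffOn_extChartAt_symm p₀)

theorem dScalar_coordVec (hφ : ContMDiff (𝓘st n) 𝓘(ℝ, ℝ) ∞ φ) {y : Vec n}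
    (hy : y ∈ (extChartAt (𝓘st n) p₀).target) (i : Idx n) :
    dScalar φ ((extChartAt (𝓘st n) p₀).symm y) (coordVec p₀ y i) =
      pd i (φ ∘ (extChartAt (𝓘st n) p₀).symm) y := by
  have h1 : MDifferentiableAt 𝓘(ℝ, Vec n) (𝓘st n) (extChartAt (𝓘st n) p₀).symm y :=
    ((contMDiffOn_extChartAt_symm (n := ∞) p₀).contMDiffAt
      ((isOpen_extChartAt_target p₀).mem_nhds hy)).mdifferentiableAt (by simp)
  have h2 := mfderiv_comp y (hφ.mdifferentiable (by simp) _) h1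
  rw [pd, ← mfderiv_eq_fderiv, h2]
  rfl

theorem comp_scalarStress (V : ℝ → ℝ) (hφ : ContMDiff (𝓘st n) 𝓘(ℝ, ℝ) ∞ φ) {y : Vec n}
    (hy : y ∈ (extChartAt (𝓘st n) p₀).target) (i j : Idx n) :
    comp (scalarStress g V φ) p₀ y i j =
      pd i (φ ∘ (extChartAt (𝓘st n) p₀).symm) y * pd j (φ ∘ (extChartAt (𝓘st n) p₀).symm) y -
        (1 / 2) * ((∑ k, (∑ l, invMetric g p₀ y k l *
          pd l (φ ∘ (extChartAt (𝓘st n) p₀).symm) y) * pd k (φ ∘ (extChartAt (𝓘st n) p₀).symm) y)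
            - 2 * V ((φ ∘ (extChartAt (𝓘st n) p₀).symm) y)) * comp g.val p₀ y i j := by
  simp only [comp, Matrix.of_apply, scalarStress, sub_apply, smul_apply,
    ContinuousLinearMap.smulRight_apply, dScalar_coordVec p₀ hφ hy, sharp_eq_sum g hy, map_sum,
    map_smul, smul_eq_mul, Function.comp_apply]

/-- This makes the scalar field an instance of the conservation argument, which is carried out for
any smooth symmetric conserved stress tensor. -/
theorem scalarStress_smooth {V : ℝ → ℝ} (hV : ContDiff ℝ ∞ V)
    (hφ : ContMDiff (𝓘st n) 𝓘(ℝ, ℝ) ∞ φ) : (scalarStress g V φ).Smooth := by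
  intro p₀ i j
  have hf := contDiffOn_comp_symm p₀ hφ
  have hp := fun i => contDiffOn_pd (isOpen_extChartAt_target p₀) hf i
  refine ContDiffOn.congr ?_ fun y hy => comp_scalarStress g p₀ V hφ hy i j
  refine ((hp i).mul (hp j)).sub ((contDiffOn_const.mul (ContDiffOn.sub ?_ ?_)).mul
    (g.smooth p₀ i j))
  · exact ContDiffOn.sum fun k _ => (ContDiffOn.sum fun l _ =>
      (contDiffOn_invMetric g p₀ k l).mul (hp l)).mul (hp k)
  · exact contDiffOn_const.mul (hV.comp_contDiffOn hf)

end Smoothness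

/-! ### Derivatives of `det` and `√|det|`. -/

section Jacobi

variable {ι E : Type*} [Fintype ι] [DecidableEq ι] [NormedAddCommGroup E] [NormedSpace ℝ E]

/-- Jacobi's formula for the derivative of a determinant. -/
theorem fderiv_det_apply {A : E → Matrix ι ι ℝ} {y : E}
    (hA : ∀ i j, DifferentiableAt ℝ (fun z => A z i j) y) (v : E) :
    fderiv ℝ (fun z => (A z).det) y v =
      ∑ k, ∑ j, (A y).adjugate k j * fderiv ℝ (fun z => A z j k) y v := by
  have h1 : HasFDerivAt (fun z => (A z).det) (∑ σ : Equiv.Perm ι, ((Equiv.Perm.sign σ : ℤ) : ℝ) •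
      ∑ k, (∏ j ∈ Finset.univ.erase k, A y (σ j) j) • fderiv ℝ (fun z => A z (σ k) k) y) y := by
    simp only [Matrix.det_apply']
    exact HasFDerivAt.fun_sum fun σ _ => (HasFDerivAt.finsetProd
      fun k _ => (hA (σ k) k).hasFDerivAt).const_mul _
  -- By Cramer's rule the left side is the determinant with column `k` replaced by its derivative;
  -- it is then expanded over permutations.
  have h2 : ∀ k, ∑ j, (A y).adjugate k j * fderiv ℝ (fun z => A z j k) y v =
      ∑ σ : Equiv.Perm ι, ((Equiv.Perm.sign σ : ℤ) : ℝ) *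
        ((∏ j ∈ Finset.univ.erase k, A y (σ j) j) * fderiv ℝ (fun z => A z (σ k) k) y v) := by
    intro k
    have : ∑ j, (A y).adjugate k j * fderiv ℝ (fun z => A z j k) y v =
        ((A y).adjugate.mulVec fun j => fderiv ℝ (fun z => A z j k) y v) k := rfl
    rw [this, ← Matrix.cramer_eq_adjugate_mulVec, Matrix.cramer_apply, Matrix.det_apply']
    refine Finset.sum_congr rfl fun σ _ => ?_
    rw [← Finset.prod_erase_mul _ _ (Finset.mem_univ k), Matrix.updateCol_self]
    congr 2
    refine Finset.prod_congr rfl fun j hj => ?_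
    rw [Matrix.updateCol_ne (Finset.ne_of_mem_erase hj)]
  rw [h1.fderiv]
  simp only [h2, sum_apply, smul_apply, smul_eq_mul, Finset.mul_sum]
  exact Finset.sum_comm

/-- Jacobi's formula divided by the determinant gives `d√|D| = ½ √|D| tr(A⁻¹ dA)`. The absolute
value is there because the determinant of a Lorentzian metric can have either sign, depending on the
dimension. -/
theorem fderiv_sqrt_abs_det_apply {A : E → Matrix ι ι ℝ} {y : E}
    (hA : ∀ i j, DifferentiableAt ℝ (fun z => A z i j) y) (h0 : (A y).det ≠ 0) (v : E) :
    fderiv ℝ (fun z => Real.sqrt |(A z).det|) y v =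
      Real.sqrt |(A y).det| * ((1 / 2) *
        ∑ k, ∑ j, (A y)⁻¹ k j * fderiv ℝ (fun z => A z j k) y v) := by
  have hd : DifferentiableAt ℝ (fun z => (A z).det) y := by
    simp only [Matrix.det_apply']
    exact DifferentiableAt.fun_sum fun σ _ => (HasFDerivAt.finsetProd
      fun k _ => (hA (σ k) k).hasFDerivAt).differentiableAt.const_mul _
  have hpos : 0 < |(A y).det| := abs_pos.2 h0
  have h1 := ((hasDerivAt_abs h0).sqrt hpos.ne').comp_hasFDerivAt y hd.hasFDerivAt
  have h2 : fderiv ℝ (fun z => Real.sqrt |(A z).det|) y = _ := h1.fderiv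
  have h3 : ∑ k, ∑ j, (A y)⁻¹ k j * fderiv ℝ (fun z => A z j k) y v =
      (A y).det⁻¹ * fderiv ℝ (fun z => (A z).det) y v := by
    simp only [fderiv_det_apply hA, Matrix.inv_def, Matrix.smul_apply, Ring.inverse_eq_inv',
      smul_eq_mul, Finset.mul_sum, mul_assoc]
  rw [h2, h3, smul_apply, smul_eq_mul]
  -- Writing the derivative of `|·|` as `|D| / D` treats both signs of `D` at once.
  have hs : (SignType.sign (A y).det : ℝ) = |(A y).det| * (A y).det⁻¹ := by
    rcases lt_or_gt_of_ne h0 with h | h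
    · rw [sign_neg h, abs_of_neg h]
      field_simp
      norm_num
    · rw [sign_pos h, abs_of_pos h]
      field_simp
      norm_num
  have hsp := Real.sqrt_pos.2 hpos
  have hsq : |(A y).det| / Real.sqrt |(A y).det| = Real.sqrt |(A y).det| := Real.div_sqrt
  rw [hs]
  calc _ = (|(A y).det| / Real.sqrt |(A y).det|) * ((1 / 2) *
        ((A y).det⁻¹ * fderiv ℝ (fun z => (A z).det) y v)) := by ring
    _ = _ := by rw [hsq]

end Jacobi

/-! ### Contracted Christoffel symbols. -/

section Contractions

variable (g : SpacetimeMetric n M) (p₀ : M × ℝ) {y : Vec n}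

/-- In `½ g^{lm} (∂_l g_{im} + ∂_i g_{lm} - ∂_m g_{li})` the outer two terms cancel by symmetry of
`g^{lm}`. What is left is the trace in Jacobi's formula, that is, the logarithmic derivative of
`√|det g|`. -/
theorem sum_Γ_self (i : Idx n) (y : Vec n) :
    ∑ l, Γ g p₀ l l i y =
      (1 / 2) * ∑ k, ∑ j, invMetric g p₀ y k j * pd i (fun z => comp g.val p₀ z j k) y := by
  simp only [Γ, mul_sub, mul_add, Finset.sum_sub_distrib, Finset.sum_add_distrib, ← Finset.mul_sum]
  have h1 : ∑ k, ∑ l, invMetric g p₀ y k l * pd l (fun z => comp g.val p₀ z k i) y =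
      ∑ k, ∑ l, invMetric g p₀ y k l * pd k (fun z => comp g.val p₀ z i l) y := by
    rw [Finset.sum_comm]
    refine Finset.sum_congr rfl fun k _ => Finset.sum_congr rfl fun l _ => ?_
    rw [invMetric_symm]
    simp only [comp_symm g.symm p₀ _ l i]
  have h2 : ∑ k, ∑ l, invMetric g p₀ y k l * pd i (fun z => comp g.val p₀ z k l) y =
      ∑ k, ∑ j, invMetric g p₀ y k j * pd i (fun z => comp g.val p₀ z j k) y :=
    Finset.sum_congr rfl fun k _ => Finset.sum_congr rfl fun l _ => by
      simp only [comp_symm g.symm p₀ _ k l]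
  rw [h1, h2]
  ring

theorem compUp_symm {T : Tensor2 n M} (hT : T.Symm) (i j : Idx n) :
    compUp g T p₀ i j y = compUp g T p₀ j i y := by
  rw [compUp, Finset.sum_comm, compUp]
  refine Finset.sum_congr rfl fun k _ => Finset.sum_congr rfl fun l _ => ?_
  rw [comp_symm hT]
  ring

end Contractions

/-! ### The energy-momentum vector of a Killing field is divergence free. -/

section Divergence

variable [IsManifold (𝓡 n) ∞ M] (g : SpacetimeMetric n M) (p₀ : M × ℝ) {y : Vec n}

/-- The volume density `√|det g|` of the spacetime in a chart. -/
def volDensity (y : Vec n) : ℝ := Real.sqrt |(comp g.val p₀ y).det|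

theorem contDiffOn_volDensity :
    ContDiffOn ℝ ∞ (volDensity g p₀) (extChartAt (𝓘st n) p₀).target := by
  have h : ContDiffOn ℝ ∞ (fun y => (comp g.val p₀ y).det) (extChartAt (𝓘st n) p₀).target :=
    contDiffOn_det fun i j => g.smooth p₀ i j
  refine ContDiffOn.sqrt (fun y hy => ?_) fun y hy =>
    (abs_pos.2 (comp_val_det_ne_zero g hy)).ne'
  exact (contDiffAt_abs (comp_val_det_ne_zero g hy)).comp_contDiffWithinAt y (h y hy)

theorem pd_volDensity (hy : y ∈ (extChartAt (𝓘st n) p₀).target) (i : Idx n) :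
    pd i (volDensity g p₀) y = volDensity g p₀ y * ∑ l, Γ g p₀ l l i y := by
  rw [sum_Γ_self]
  exact fderiv_sqrt_abs_det_apply (fun i j => ((g.smooth p₀ i j).contDiffAt
    ((isOpen_extChartAt_target p₀).mem_nhds hy)).differentiableAt (by simp))
      (comp_val_det_ne_zero g hy) _

theorem pd_mul {f h : Vec n → ℝ} (hf : DifferentiableAt ℝ f y) (hh : DifferentiableAt ℝ h y)
    (i : Idx n) : pd i (fun z => f z * h z) y = pd i f y * h y + f y * pd i h y := by
  rw [pd, fderiv_fun_mul hf hh, add_apply, smul_apply, smul_apply]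
  simp only [smul_eq_mul, pd]
  ring

theorem pd_sum {ι : Type*} (s : Finset ι) {f : ι → Vec n → ℝ}
    (hf : ∀ k ∈ s, DifferentiableAt ℝ (f k) y) (i : Idx n) :
    pd i (fun z => ∑ k ∈ s, f k z) y = ∑ k ∈ s, pd i (f k) y := by
  rw [pd, fderiv_fun_sum hf, sum_apply]
  rfl

/-- The densitized energy-momentum vector of a conserved stress tensor relative to a Killing field
is divergence free. -/
theorem sum_pd_volDensity_mul_energyMomentumComp {X : VField n M} (hX : X.Smooth)
    (hK : IsKilling g X) {T : Tensor2 n M} (hT : T.Smooth) (hTs : T.Symm) (hTc : IsConserved g T)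
    (hy : y ∈ (extChartAt (𝓘st n) p₀).target) :
    ∑ i, pd i (fun z => volDensity g p₀ z * energyMomentumComp g X T p₀ i z) y = 0 := by
  have hnhds := (isOpen_extChartAt_target p₀).mem_nhds hy
  have dif : ∀ {f : Vec n → ℝ}, ContDiffOn ℝ ∞ f (extChartAt (𝓘st n) p₀).target →
      DifferentiableAt ℝ f y := fun h => (h.contDiffAt hnhds).differentiableAt (by simp)
  have dV := dif (contDiffOn_volDensity g p₀)
  have dU := fun i j => dif (contDiffOn_compUp g p₀ hT i j)
  have dL := fun j => dif (contDiffOn_lowered g p₀ hX j)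
  have hP : ∀ i, pd i (energyMomentumComp g X T p₀ i) y =
      ∑ j, (pd i (compUp g T p₀ i j) y * lowered g X p₀ j y +
        compUp g T p₀ i j y * pd i (lowered g X p₀ j) y) := by
    intro i
    have := pd_sum Finset.univ (f := fun j z => compUp g T p₀ i j z * lowered g X p₀ j z)
      (fun j _ => (dU i j).mul (dL j)) i
    simp only [pd_mul (dU i _) (dL _)] at this
    exact this
  have hdiv : ∀ j, ∑ i, pd i (compUp g T p₀ i j) y = -∑ i, ∑ l, (Γ g p₀ i i l y *
      compUp g T p₀ l j y + Γ g p₀ j i l y * compUp g T p₀ i l y) := fun j =>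
    eq_neg_of_add_eq_zero_left (hTc p₀ y hy j)
  -- Contraction with the symmetric `T^{ij}` kills the antisymmetric `∇_i X_j`, so `∂_i X_j` may be
  -- replaced by `Γ^k_{ij} X_k`.
  have hkil : ∑ i, ∑ j, compUp g T p₀ i j y * pd i (lowered g X p₀ j) y =
      ∑ i, ∑ j, compUp g T p₀ i j y * ∑ k, Γ g p₀ k i j y * lowered g X p₀ k y := by
    have h1 : ∑ i, ∑ j, compUp g T p₀ i j y * covDeriv g X p₀ i j y = 0 := by
      have h2 : ∑ i, ∑ j, compUp g T p₀ i j y * covDeriv g X p₀ i j y =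
          -∑ i, ∑ j, compUp g T p₀ i j y * covDeriv g X p₀ i j y := by
        conv_rhs => rw [Finset.sum_comm]
        simp only [← Finset.sum_neg_distrib]
        refine Finset.sum_congr rfl fun i _ => Finset.sum_congr rfl fun j _ => ?_
        rw [compUp_symm g p₀ hTs j i, eq_neg_of_add_eq_zero_left (hK p₀ y hy i j), mul_neg]
      linarith
    simp only [covDeriv, mul_sub, Finset.sum_sub_distrib] at h1
    exact sub_eq_zero.1 h1
  -- `e1` and `e2` identify the two Christoffel terms of `∇_i T^{ij}`, contracted with `X_j`: the
  -- first is `Γ^l_{li} P^i`, the second is the term produced by the Killing equation and cancels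
  -- against it.
  have e1 : ∑ i, (∑ l, Γ g p₀ l l i y) * energyMomentumComp g X T p₀ i y =
      ∑ j, (∑ i, ∑ l, Γ g p₀ i i l y * compUp g T p₀ l j y) * lowered g X p₀ j y := by
    simp only [energyMomentumComp, Finset.mul_sum, Finset.sum_mul]
    rw [Finset.sum_comm]
    refine Finset.sum_congr rfl fun j _ => ?_
    rw [Finset.sum_comm]
    exact Finset.sum_congr rfl fun k _ => Finset.sum_congr rfl fun l _ => by ring
  have e2 : ∑ i, ∑ j, compUp g T p₀ i j y * ∑ k, Γ g p₀ k i j y * lowered g X p₀ k y =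
      ∑ j, (∑ i, ∑ l, Γ g p₀ j i l y * compUp g T p₀ i l y) * lowered g X p₀ j y := by
    simp only [Finset.mul_sum, Finset.sum_mul]
    rw [Finset.sum_comm_cycle]
    exact Finset.sum_congr rfl fun j _ => Finset.sum_congr rfl fun k _ =>
      Finset.sum_congr rfl fun l _ => by ring
  -- The remaining term is exactly what the derivative of `√|det g|` compensates.
  have e3 : ∑ i, pd i (energyMomentumComp g X T p₀ i) y =
      -∑ i, (∑ l, Γ g p₀ l l i y) * energyMomentumComp g X T p₀ i y := by
    simp only [hP, Finset.sum_add_distrib]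
    rw [hkil, e2, Finset.sum_comm, e1]
    simp only [← Finset.sum_mul, hdiv, Finset.sum_add_distrib, neg_mul, add_mul,
      Finset.sum_neg_distrib]
    ring
  simp only [pd_mul dV (dif (contDiffOn_energyMomentumComp g p₀ hX hT _)),
    pd_volDensity g p₀ hy, Finset.sum_add_distrib, ← Finset.mul_sum, mul_assoc, e3]
  ring

end Divergence

/-! ### Product charts: slice quantities against spacetime quantities. -/

section ProductChart

variable (g : SpacetimeMetric n M) {m₀ : M} {x : EuclideanSpace ℝ (Fin n)} {t : ℝ}

/-- The time coordinate is untouched and the chart target is a full cylinder over the target in `M`.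
The time label `s` of the chart is thus immaterial, and `0` is used for it below. -/
theorem extChartAt_spacetime (m₀ : M) (s : ℝ) :
    extChartAt (𝓘st n) (m₀, s) = (extChartAt (𝓡 n) m₀).prod (PartialEquiv.refl ℝ) := by
  rw [extChartAt_prod, extChartAt_model_space_eq_id]

theorem mem_target_spacetime (s : ℝ) (hx : x ∈ (extChartAt (𝓡 n) m₀).target) (t : ℝ) :
    (x, t) ∈ (extChartAt (𝓘st n) (m₀, s)).target := by
  rw [extChartAt_spacetime]
  exact ⟨hx, Set.mem_univ t⟩

theorem symm_spacetime (m₀ : M) (s : ℝ) (x : EuclideanSpace ℝ (Fin n)) (t : ℝ) :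
    (extChartAt (𝓘st n) (m₀, s)).symm (x, t) = ((extChartAt (𝓡 n) m₀).symm x, t) := rfl

theorem dScalar_comp_fst {f : M → ℝ} (hf : ContMDiff (𝓡 n) 𝓘(ℝ, ℝ) ∞ f) :
    ContMDiff (𝓘st n) 𝓘(ℝ, ℝ) ∞ (fun q : M × ℝ => f q.1) := hf.comp contMDiff_fst

variable [IsManifold (𝓡 n) ∞ M]

theorem mdifferentiableAt_extChartAt_symm_of_mem (hx : x ∈ (extChartAt (𝓡 n) m₀).target) :
    MDifferentiableAt 𝓘(ℝ, EuclideanSpace ℝ (Fin n)) (𝓡 n) (extChartAt (𝓡 n) m₀).symm x :=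
  ((contMDiffOn_extChartAt_symm (n := ∞) m₀).contMDiffAt
    ((isOpen_extChartAt_target m₀).mem_nhds hx)).mdifferentiableAt (by simp)

theorem mfderiv_symm_spacetime (s : ℝ) (hx : x ∈ (extChartAt (𝓡 n) m₀).target) (v : Vec n) :
    (mfderiv 𝓘(ℝ, Vec n) (𝓘st n) (extChartAt (𝓘st n) (m₀, s)).symm (x, t) v : Vec n) =
      ((mfderiv 𝓘(ℝ, EuclideanSpace ℝ (Fin n)) (𝓡 n) (extChartAt (𝓡 n) m₀).symm x v.1 :
        EuclideanSpace ℝ (Fin n)), v.2) := by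
  have h1 : HasMFDerivAt 𝓘(ℝ, Vec n) 𝓘(ℝ, EuclideanSpace ℝ (Fin n)) (Prod.fst : Vec n → _) (x, t)
      (ContinuousLinearMap.fst ℝ (EuclideanSpace ℝ (Fin n)) ℝ) := hasFDerivAt_fst.hasMFDerivAt
  have h2 : HasMFDerivAt 𝓘(ℝ, Vec n) 𝓘(ℝ, ℝ) (Prod.snd : Vec n → ℝ) (x, t)
      (ContinuousLinearMap.snd ℝ (EuclideanSpace ℝ (Fin n)) ℝ) := hasFDerivAt_snd.hasMFDerivAt
  have h3 : HasMFDerivAt 𝓘(ℝ, Vec n) (𝓘st n) (extChartAt (𝓘st n) (m₀, s)).symm (x, t) _ :=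
    (((mdifferentiableAt_extChartAt_symm_of_mem hx).hasMFDerivAt).comp (x, t) h1).prodMk h2
  rw [h3.mfderiv]
  rfl

theorem coordVec_inl (s : ℝ) (hx : x ∈ (extChartAt (𝓡 n) m₀).target) (i : Fin n) :
    (coordVec (m₀, s) (x, t) (Sum.inl i) : Vec n) =
      ((mfderiv 𝓘(ℝ, EuclideanSpace ℝ (Fin n)) (𝓡 n) (extChartAt (𝓡 n) m₀).symm x
        (EuclideanSpace.single i (1 : ℝ) : EuclideanSpace ℝ (Fin n)) :
          EuclideanSpace ℝ (Fin n)), 0) :=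
  mfderiv_symm_spacetime s hx _

theorem coordVec_inr (s : ℝ) (hx : x ∈ (extChartAt (𝓡 n) m₀).target) (i : Unit) :
    (coordVec (m₀, s) (x, t) (Sum.inr i) : Vec n) = (0, 1) := by
  refine (mfderiv_symm_spacetime s hx _).trans ?_
  exact Prod.ext (map_zero (mfderiv 𝓘(ℝ, EuclideanSpace ℝ (Fin n)) (𝓡 n)
    (extChartAt (𝓡 n) m₀).symm x)) rfl

theorem spatialComp_eq_neg_block (s : ℝ) (hx : x ∈ (extChartAt (𝓡 n) m₀).target) :
    spatialComp g t m₀ x = -(comp g.val (m₀, s) (x, t)).toBlocks₁₁ := by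
  ext i j
  rw [Matrix.neg_apply, Matrix.toBlocks₁₁, Matrix.of_apply, comp, Matrix.of_apply]
  have h := fun i => coordVec_inl (t := t) s hx i
  change _ = -g.val ((extChartAt (𝓡 n) m₀).symm x, t) (coordVec (m₀, s) (x, t) (Sum.inl i) : Vec n)
    (coordVec (m₀, s) (x, t) (Sum.inl j) : Vec n)
  rw [h, h]
  rfl

theorem injective_mfderiv_extChartAt_symm (hx : x ∈ (extChartAt (𝓡 n) m₀).target) :
    Function.Injective (mfderiv 𝓘(ℝ, EuclideanSpace ℝ (Fin n)) (𝓡 n)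
      (extChartAt (𝓡 n) m₀).symm x) := by
  have : IsManifold (𝓡 n) 1 M := .of_le (n := ∞) (by simp)
  have := (isInvertible_mfderivWithin_extChartAt_symm hx).injective
  rwa [ModelWithCorners.range_eq_univ, mfderivWithin_univ] at this

/-- The quadratic form of `h` at `c` is `-g(K v, K v)`, with `v = ∑ c i • e_i` and `K` the
derivative of the inverse chart followed by inclusion into the spacetime tangent space. Slices are
spacelike, and the derivative is injective. -/
theorem spatialComp_posDef (hx : x ∈ (extChartAt (𝓡 n) m₀).target) :
    (spatialComp g t m₀ x).PosDef := by
  set L := mfderiv 𝓘(ℝ, EuclideanSpace ℝ (Fin n)) (𝓡 n) (extChartAt (𝓡 n) m₀).symm x with hL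
  refine Matrix.PosDef.of_dotProduct_mulVec_pos ?_ fun c hc => ?_
  · ext i j
    rw [Matrix.conjTranspose_apply, star_trivial, spatialComp_eq_neg_block g 0 hx, Matrix.neg_apply,
      Matrix.neg_apply]
    exact congrArg _ (comp_symm g.symm _ _ _ _)
  · set v : EuclideanSpace ℝ (Fin n) := ∑ i, c i • EuclideanSpace.single i (1 : ℝ) with hv
    have hv0 : v ≠ 0 := by
      intro h0
      apply hc
      ext i
      have := congrArg (fun w : EuclideanSpace ℝ (Fin n) => w i) h0
      simpa [hv, Finset.sum_apply, Pi.single_apply] using this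
    have hLv : (L v : EuclideanSpace ℝ (Fin n)) ≠ 0 := fun h0 =>
      hv0 (injective_mfderiv_extChartAt_symm hx (h0.trans (map_zero L).symm))
    have hs := g.spacelike ((extChartAt (𝓡 n) m₀).symm x, t) (L v) hLv
    let K : EuclideanSpace ℝ (Fin n) →ₗ[ℝ]
        TangentSpace (𝓘st n) ((extChartAt (𝓡 n) m₀).symm x, t) :=
      { toFun := fun w => ((L w, 0) : Vec n)
        map_add' := fun a b => Prod.ext (map_add L a b) (add_zero (0 : ℝ)).symm
        map_smul' := fun a b => Prod.ext (map_smul L a b) (smul_zero a).symm }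
    have hK : g.val ((extChartAt (𝓡 n) m₀).symm x, t) (K v) (K v) < 0 := hs
    have hexp : g.val ((extChartAt (𝓡 n) m₀).symm x, t) (K v) (K v) =
        -(star c ⬝ᵥ (spatialComp g t m₀ x).mulVec c) := by
      have he : ∀ i j, spatialComp g t m₀ x i j = -g.val ((extChartAt (𝓡 n) m₀).symm x, t)
        (K (EuclideanSpace.single i 1)) (K (EuclideanSpace.single j 1)) := fun i j => rfl
      simp only [hv, map_sum, map_smul, sum_apply, smul_apply, smul_eq_mul, star_trivial,
        dotProduct, Matrix.mulVec, he, Finset.mul_sum]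
      rw [Finset.sum_comm]
      simp only [← Finset.sum_neg_distrib]
      refine Finset.sum_congr rfl fun i _ => Finset.sum_congr rfl fun j _ => ?_
      ring
    linarith

/-- This is `dμ = lapse dμ_t dt` in coordinates. The coordinate basis is adapted to the slices, so
`det_spatial_block` gives `det h = g^{tt} |det g|`; the sign from `h = -g` disappears in the
absolute value because `det h > 0`. -/
theorem lapse_mul_sqrt_det_spatialComp (hx : x ∈ (extChartAt (𝓡 n) m₀).target) (t : ℝ) :
    lapse g ((extChartAt (𝓡 n) m₀).symm x, t) * Real.sqrt (spatialComp g t m₀ x).det =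
      volDensity g (m₀, 0) (x, t) := by
  have hy := mem_target_spacetime 0 hx t
  have hb := det_spatial_block g _ (chartBasis (m₀, 0) hy)
    (fun i => by rw [chartBasis_apply, coordVec_inl 0 hx])
    (by rw [chartBasis_apply, coordVec_inr 0 hx])
  rw [gram_chartBasis, symm_spacetime] at hb
  have hpos := (spatialComp_posDef g (t := t) hx).det_pos
  have habs : (spatialComp g t m₀ x).det = gtt g ((extChartAt (𝓡 n) m₀).symm x, t) *
      |(comp g.val (m₀, 0) (x, t)).det| := by
    rw [← abs_of_pos hpos, spatialComp_eq_neg_block g 0 hx, Matrix.det_neg, hb, abs_mul, abs_pow,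
      abs_neg, abs_one, one_pow, one_mul, abs_mul, abs_of_pos (gtt_pos g _)]
  have hg := gtt_pos g ((extChartAt (𝓡 n) m₀).symm x, t)
  rw [habs, Real.sqrt_mul hg.le, lapse, volDensity, inv_mul_cancel_left₀ (Real.sqrt_pos.2 hg).ne']

theorem contDiffOn_det_spatialComp (m₀ : M) (t : ℝ) :
    ContDiffOn ℝ ∞ (fun x => (spatialComp g t m₀ x).det) (extChartAt (𝓡 n) m₀).target := by
  refine contDiffOn_det fun i j => ContDiffOn.congr (f := fun x =>
    -comp g.val (m₀, 0) (x, t) (Sum.inl i) (Sum.inl j)) ?_ fun x hx => ?_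
  · exact ((g.smooth (m₀, 0) (Sum.inl i) (Sum.inl j)).comp
      (contDiff_id.prodMk contDiff_const).contDiffOn fun x hx => mem_target_spacetime 0 hx t).neg
  · rw [spatialComp_eq_neg_block g 0 hx]
    rfl

theorem apply_energyMomentum {p₀ : M × ℝ} {y : Vec n} (hy : y ∈ (extChartAt (𝓘st n) p₀).target)
    (X : VField n M) {T : Tensor2 n M} (hT : T.Symm)
    (η : TangentSpace (𝓘st n) ((extChartAt (𝓘st n) p₀).symm y) →L[ℝ] ℝ) :
    η (energyMomentum g X T ((extChartAt (𝓘st n) p₀).symm y)) =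
      ∑ i, energyMomentumComp g X T p₀ i y * η (coordVec p₀ y i) := by
  rw [energyMomentum_eq_sum g hy X hT, map_sum]
  simp only [map_smul, smul_eq_mul]

/-- The energy density in the product chart, densitized. -/
theorem sqrt_det_mul_energyDensity (X : VField n M) {T : Tensor2 n M} (hT : T.Symm)
    (hx : x ∈ (extChartAt (𝓡 n) m₀).target) (t : ℝ) :
    Real.sqrt (spatialComp g t m₀ x).det *
        energyDensity g X T t ((extChartAt (𝓡 n) m₀).symm x) =
      volDensity g (m₀, 0) (x, t) * energyMomentumComp g X T (m₀, 0) (Sum.inr ()) (x, t) := by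
  have h2 : dt (n := n) ((extChartAt (𝓡 n) m₀).symm x, t)
      (energyMomentum g X T ((extChartAt (𝓡 n) m₀).symm x, t)) =
        energyMomentumComp g X T (m₀, 0) (Sum.inr ()) (x, t) := by
    refine (apply_energyMomentum g (mem_target_spacetime 0 hx t) X hT (dt _)).trans ?_
    simp only [dt_apply, Fintype.sum_sum_type]
    simp [coordVec_inl 0 hx, coordVec_inr 0 hx]
  rw [energyDensity_eq_lapse_mul, ← dt_apply, h2, ← lapse_mul_sqrt_det_spatialComp g hx]
  ring

/-- The flux of the energy-momentum vector through the level sets of a function on `M` in the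
product chart, densitized. -/
theorem sqrt_det_mul_lapse_mul_dScalar (X : VField n M) {T : Tensor2 n M} (hT : T.Symm)
    {f : M → ℝ} (hf : ContMDiff (𝓡 n) 𝓘(ℝ, ℝ) ∞ f)
    (hx : x ∈ (extChartAt (𝓡 n) m₀).target) (t : ℝ) :
    Real.sqrt (spatialComp g t m₀ x).det * (lapse g ((extChartAt (𝓡 n) m₀).symm x, t) *
      dScalar (n := n) (fun q : M × ℝ => f q.1) ((extChartAt (𝓡 n) m₀).symm x, t)
        (energyMomentum g X T ((extChartAt (𝓡 n) m₀).symm x, t))) =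
      ∑ i : Fin n, fderiv ℝ (f ∘ (extChartAt (𝓡 n) m₀).symm) x (EuclideanSpace.single i 1) *
        (volDensity g (m₀, 0) (x, t) *
          energyMomentumComp g X T (m₀, 0) (Sum.inl i) (x, t)) := by
  have hy := mem_target_spacetime 0 hx t
  have hd : DifferentiableAt ℝ (f ∘ (extChartAt (𝓡 n) m₀).symm) x :=
    (mdifferentiableAt_iff_differentiableAt.1 ((hf.mdifferentiable (by simp) _).comp x
      (mdifferentiableAt_extChartAt_symm_of_mem hx)))
  have h3 : ∀ i, dScalar (n := n) (fun q : M × ℝ => f q.1) ((extChartAt (𝓡 n) m₀).symm x, t)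
      (coordVec (m₀, 0) (x, t) i) = fderiv ℝ (f ∘ (extChartAt (𝓡 n) m₀).symm) x
        (stdVec i : Vec n).1 := by
    intro i
    refine (dScalar_coordVec (m₀, (0 : ℝ)) (dScalar_comp_fst hf) hy i).trans ?_
    have : HasFDerivAt ((fun q : M × ℝ => f q.1) ∘ (extChartAt (𝓘st n) (m₀, (0 : ℝ))).symm)
        ((fderiv ℝ (f ∘ (extChartAt (𝓡 n) m₀).symm) x).comp
          (ContinuousLinearMap.fst ℝ (EuclideanSpace ℝ (Fin n)) ℝ)) (x, t) :=
      HasFDerivAt.comp (f := Prod.fst) (g := f ∘ (extChartAt (𝓡 n) m₀).symm) (x, t)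
        hd.hasFDerivAt hasFDerivAt_fst
    rw [pd, this.fderiv]
    rfl
  have h4 := apply_energyMomentum g hy X hT
    (dScalar (n := n) (fun q : M × ℝ => f q.1) ((extChartAt (𝓡 n) m₀).symm x, t))
  rw [← lapse_mul_sqrt_det_spatialComp g hx]
  refine (congrArg (fun z => Real.sqrt (spatialComp g t m₀ x).det *
    (lapse g ((extChartAt (𝓡 n) m₀).symm x, t) * z)) (h4.trans
      (Finset.sum_congr rfl fun i _ => congrArg (fun z => _ * z) (h3 i)))).trans ?_
  simp only [Fintype.sum_sum_type, stdVec, map_zero, mul_zero, Finset.sum_const_zero, add_zero,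
    Finset.mul_sum]
  exact Finset.sum_congr rfl fun i _ => by ring

end ProductChart

/-! ### Gram determinants under a linear change of vectors. -/

section Gram

/-- Precomposition with `J` turns the Gram matrix `G` into `Jᵀ G J`. The resulting square is what
makes `√det h` transform as a density. -/
theorem det_of_comp {ι W F : Type*} [Fintype ι] [DecidableEq ι] [AddCommGroup W]
    [Module ℝ W] [AddCommGroup F] [Module ℝ F] (B : F →ₗ[ℝ] F →ₗ[ℝ] ℝ)
    (b : Module.Basis ι ℝ W) (K : W →ₗ[ℝ] F) (J : W →ₗ[ℝ] W) :
    (Matrix.of fun i j => B (K (J (b i))) (K (J (b j)))).det =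
      LinearMap.det J ^ 2 * (Matrix.of fun i j => B (K (b i)) (K (b j))).det := by
  have h : (Matrix.of fun i j => B (K (J (b i))) (K (J (b j)))) =
      (LinearMap.toMatrix b b J).transpose * (Matrix.of fun i j => B (K (b i)) (K (b j))) *
        LinearMap.toMatrix b b J := by
    ext i j
    have e : ∀ i, J (b i) = ∑ k, LinearMap.toMatrix b b J k i • b k := fun i => by
      simp only [LinearMap.toMatrix_apply, b.sum_repr]
    rw [Matrix.of_apply, e i, e j, Matrix.mul_apply]
    simp only [map_sum, map_smul, LinearMap.sum_apply, LinearMap.smul_apply, smul_eq_mul,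
      Matrix.mul_apply, Matrix.transpose_apply, Matrix.of_apply, Finset.sum_mul, Finset.mul_sum]
    exact Finset.sum_congr rfl fun k _ => Finset.sum_congr rfl fun l _ => by ring
  rw [h, Matrix.det_mul, Matrix.det_mul, Matrix.det_transpose, LinearMap.det_toMatrix]
  ring

end Gram

/-! ### The volume measure of a slice. -/

section SliceVolume

variable [IsManifold (𝓡 n) ∞ M] (g : SpacetimeMetric n M) (t : ℝ) (m₀ m₁ : M)

/-- The transition map between two charts of `M`. -/
def transition (x : EuclideanSpace ℝ (Fin n)) : EuclideanSpace ℝ (Fin n) :=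
  extChartAt (𝓡 n) m₁ ((extChartAt (𝓡 n) m₀).symm x)

variable {m₀ m₁} {x : EuclideanSpace ℝ (Fin n)}

theorem differentiableAt_transition (hx : x ∈ (extChartAt (𝓡 n) m₀).target)
    (hx' : (extChartAt (𝓡 n) m₀).symm x ∈ (extChartAt (𝓡 n) m₁).source) :
    DifferentiableAt ℝ (transition (n := n) m₀ m₁) x := by
  have : IsManifold (𝓡 n) 1 M := .of_le (n := ∞) (by simp)
  rw [extChartAt_source] at hx'
  exact mdifferentiableAt_iff_differentiableAt.1
    ((mdifferentiableAt_extChartAt hx').comp x (mdifferentiableAt_extChartAt_symm_of_mem hx))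

/-- By the chain rule the coordinate vectors of one chart are those of the other composed with the
derivative of the transition map; `det_of_comp` applies with that derivative as `J`. -/
theorem det_spatialComp_transition (hx : x ∈ (extChartAt (𝓡 n) m₀).target)
    (hx' : (extChartAt (𝓡 n) m₀).symm x ∈ (extChartAt (𝓡 n) m₁).source) :
    (spatialComp g t m₀ x).det = (fderiv ℝ (transition (n := n) m₀ m₁) x).det ^ 2 *
      (spatialComp g t m₁ (transition (n := n) m₀ m₁ x)).det := by
  set τ := transition (n := n) m₀ m₁ with hτ
  have hτx : τ x ∈ (extChartAt (𝓡 n) m₁).target := (extChartAt (𝓡 n) m₁).map_source hx'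
  have hback : (extChartAt (𝓡 n) m₁).symm (τ x) = (extChartAt (𝓡 n) m₀).symm x :=
    (extChartAt (𝓡 n) m₁).left_inv hx'
  have hloc : (extChartAt (𝓡 n) m₀).symm =ᶠ[𝓝 x] (extChartAt (𝓡 n) m₁).symm ∘ τ := by
    have hc : ContinuousAt (extChartAt (𝓡 n) m₀).symm x :=
      (mdifferentiableAt_extChartAt_symm_of_mem hx).continuousAt
    filter_upwards [hc ((isOpen_extChartAt_source (I := 𝓡 n) m₁).mem_nhds hx')] with z hz
    exact ((extChartAt (𝓡 n) m₁).left_inv hz).symm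
  have hL : ∀ v : EuclideanSpace ℝ (Fin n),
      (mfderiv 𝓘(ℝ, EuclideanSpace ℝ (Fin n)) (𝓡 n) (extChartAt (𝓡 n) m₀).symm x v :
        EuclideanSpace ℝ (Fin n)) =
      mfderiv 𝓘(ℝ, EuclideanSpace ℝ (Fin n)) (𝓡 n) (extChartAt (𝓡 n) m₁).symm (τ x)
        (fderiv ℝ τ x v) := by
    intro v
    have h1 := (mdifferentiableAt_extChartAt_symm_of_mem hτx).hasMFDerivAt.comp x
      (differentiableAt_transition hx hx').hasFDerivAt.hasMFDerivAt
    have h2 := (h1.congr_of_eventuallyEq hloc).mfderiv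
    exact congrArg (fun (A : EuclideanSpace ℝ (Fin n) →L[ℝ] EuclideanSpace ℝ (Fin n)) => A v) h2
  let B : Vec n →L[ℝ] Vec n →L[ℝ] ℝ := g.val ((extChartAt (𝓡 n) m₀).symm x, t)
  let B' : Vec n →ₗ[ℝ] Vec n →ₗ[ℝ] ℝ :=
    { toFun := fun u => -(B u).toLinearMap
      map_add' := fun u v => by rw [map_add]; ext w <;> simp [add_comm]
      map_smul' := fun u v => by rw [map_smul]; ext w <;> simp }
  let L : EuclideanSpace ℝ (Fin n) →L[ℝ] EuclideanSpace ℝ (Fin n) :=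
    mfderiv 𝓘(ℝ, EuclideanSpace ℝ (Fin n)) (𝓡 n) (extChartAt (𝓡 n) m₁).symm (τ x)
  let K : EuclideanSpace ℝ (Fin n) →ₗ[ℝ] Vec n := LinearMap.inl ℝ _ _ ∘ₗ L.toLinearMap
  have hb : ∀ i, (EuclideanSpace.basisFun (Fin n) ℝ).toBasis i = EuclideanSpace.single i 1 :=
    fun i => by simp [EuclideanSpace.basisFun_apply]
  have key := det_of_comp B' (EuclideanSpace.basisFun (Fin n) ℝ).toBasis K
    (fderiv ℝ τ x).toLinearMap
  simp only [hb] at key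
  have e0 : spatialComp g t m₀ x = Matrix.of fun i j =>
      B' (K ((fderiv ℝ τ x).toLinearMap (EuclideanSpace.single i 1)))
        (K ((fderiv ℝ τ x).toLinearMap (EuclideanSpace.single j 1))) := by
    ext i j
    change -B ((mfderiv 𝓘(ℝ, EuclideanSpace ℝ (Fin n)) (𝓡 n) (extChartAt (𝓡 n) m₀).symm x
      (EuclideanSpace.single i (1 : ℝ) : EuclideanSpace ℝ (Fin n)) :
        EuclideanSpace ℝ (Fin n)), (0 : ℝ))
      ((mfderiv 𝓘(ℝ, EuclideanSpace ℝ (Fin n)) (𝓡 n) (extChartAt (𝓡 n) m₀).symm x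
      (EuclideanSpace.single j (1 : ℝ) : EuclideanSpace ℝ (Fin n)) :
        EuclideanSpace ℝ (Fin n)), (0 : ℝ)) = _
    rw [hL, hL]
    rfl
  have e1 : spatialComp g t m₁ (τ x) = Matrix.of fun i j =>
      B' (K (EuclideanSpace.single i 1)) (K (EuclideanSpace.single j 1)) := by
    ext i j
    have hB : ∀ u v : Vec n, (g.val ((extChartAt (𝓡 n) m₁).symm (τ x), t) u v : ℝ) = B u v := by
      intro u v
      rw [hback]
      rfl
    exact congrArg Neg.neg (hB _ _)
  rw [e0, e1, key]

variable [MeasurableSpace M] [BorelSpace M]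

/-- The Riemannian volume density `√(det h)` of a slice in a chart of `M`. -/
def sliceDensity (m₀ : M) (x : EuclideanSpace ℝ (Fin n)) : ℝ :=
  Real.sqrt (spatialComp g t m₀ x).det

omit [MeasurableSpace M] [BorelSpace M] in
theorem continuousOn_sliceDensity (m₀ : M) :
    ContinuousOn (sliceDensity g t m₀) (extChartAt (𝓡 n) m₀).target :=
  (contDiffOn_det_spatialComp g m₀ t).continuousOn.sqrt

omit [MeasurableSpace M] [BorelSpace M] in
theorem sliceDensity_pos (hx : x ∈ (extChartAt (𝓡 n) m₀).target) : 0 < sliceDensity g t m₀ x :=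
  Real.sqrt_pos.2 (spatialComp_posDef g hx).det_pos

omit [IsManifold (𝓡 n) ∞ M] [BorelSpace M] in
theorem chartVolume_eq_map (m₀ : M) : chartVolume g t m₀ =
    (((volume : Measure (EuclideanSpace ℝ (Fin n))).restrict
      (extChartAt (𝓡 n) m₀).target).withDensity
        fun x => ENNReal.ofReal (sliceDensity g t m₀ x)).map (extChartAt (𝓡 n) m₀).symm := rfl

omit [IsManifold (𝓡 n) ∞ M] in
theorem aemeasurable_extChartAt_symm (m₀ : M) : AEMeasurable (extChartAt (𝓡 n) m₀).symm
    ((volume : Measure (EuclideanSpace ℝ (Fin n))).restrict (extChartAt (𝓡 n) m₀).target) :=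
  (continuousOn_extChartAt_symm m₀).aemeasurable₀
    (isOpen_extChartAt_target m₀).measurableSet.nullMeasurableSet

omit [IsManifold (𝓡 n) ∞ M] in
theorem aemeasurable_extChartAt_symm_withDensity (m₀ : M) : AEMeasurable (extChartAt (𝓡 n) m₀).symm
    (((volume : Measure (EuclideanSpace ℝ (Fin n))).restrict
      (extChartAt (𝓡 n) m₀).target).withDensity fun x => ENNReal.ofReal (sliceDensity g t m₀ x)) :=
  (aemeasurable_extChartAt_symm m₀).mono_ac (withDensity_absolutelyContinuous _ _)

omit [IsManifold (𝓡 n) ∞ M] in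
theorem chartVolume_apply (m₀ : M) {A : Set M} (hA : MeasurableSet A) :
    chartVolume g t m₀ A = ∫⁻ x in (extChartAt (𝓡 n) m₀).symm ⁻¹' A ∩ (extChartAt (𝓡 n) m₀).target,
      ENNReal.ofReal (sliceDensity g t m₀ x) := by
  rw [chartVolume_eq_map, Measure.map_apply_of_aemeasurable
    (aemeasurable_extChartAt_symm_withDensity g t m₀) hA, withDensity_apply',
    Measure.restrict_restrict' (isOpen_extChartAt_target m₀).measurableSet]

omit [IsManifold (𝓡 n) ∞ M] in
theorem measurableSet_symm_preimage_inter (m₀ : M) {A : Set M} (hA : MeasurableSet A) :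
    MeasurableSet ((extChartAt (𝓡 n) m₀).symm ⁻¹' A ∩ (extChartAt (𝓡 n) m₀).target) := by
  have hT := (isOpen_extChartAt_target (I := 𝓡 n) m₀).measurableSet
  have h := (continuousOn_extChartAt_symm (I := 𝓡 n) m₀).domRestrict.measurable hA
  have h2 := hT.subtype_image h
  convert h2 using 1
  ext z
  constructor
  · rintro ⟨h1, h3⟩
    exact ⟨⟨z, h3⟩, h1, rfl⟩
  · rintro ⟨⟨w, hw⟩, h1, rfl⟩
    exact ⟨h1, hw⟩

/-- The volume measures of two charts agree on the overlap. -/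
theorem chartVolume_eq_of_subset {A : Set M} (hA : MeasurableSet A)
    (h0 : A ⊆ (extChartAt (𝓡 n) m₀).source) (h1 : A ⊆ (extChartAt (𝓡 n) m₁).source) :
    chartVolume g t m₀ A = chartVolume g t m₁ A := by
  rw [chartVolume_apply g t m₀ hA, chartVolume_apply g t m₁ hA]
  set S := (extChartAt (𝓡 n) m₀).symm ⁻¹' A ∩ (extChartAt (𝓡 n) m₀).target with hS
  have himg : (extChartAt (𝓡 n) m₁).symm ⁻¹' A ∩ (extChartAt (𝓡 n) m₁).target =
      transition (n := n) m₀ m₁ '' S := by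
    ext z
    constructor
    · rintro ⟨hz, hz'⟩
      refine ⟨extChartAt (𝓡 n) m₀ ((extChartAt (𝓡 n) m₁).symm z), ⟨?_,
        (extChartAt (𝓡 n) m₀).map_source (h0 hz)⟩, ?_⟩
      · rwa [Set.mem_preimage, (extChartAt (𝓡 n) m₀).left_inv (h0 hz)]
      · rw [transition, (extChartAt (𝓡 n) m₀).left_inv (h0 hz),
          (extChartAt (𝓡 n) m₁).right_inv hz']
    · rintro ⟨x, ⟨hx, hx'⟩, rfl⟩
      refine ⟨?_, (extChartAt (𝓡 n) m₁).map_source (h1 hx)⟩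
      rwa [Set.mem_preimage, transition, (extChartAt (𝓡 n) m₁).left_inv (h1 hx)]
  rw [himg, lintegral_image_eq_lintegral_abs_det_fderiv_mul volume
    (measurableSet_symm_preimage_inter m₀ hA) (f' := fderiv ℝ (transition (n := n) m₀ m₁))
    (fun x hx => (differentiableAt_transition hx.2 (h1 hx.1)).hasFDerivAt.hasFDerivWithinAt) ?_]
  -- In the change of variables the Jacobian `|det Dτ|` is absorbed by the transformation of `√det
  -- h`.
  · refine setLIntegral_congr_fun (measurableSet_symm_preimage_inter m₀ hA) fun x hx => ?_
    rw [← ENNReal.ofReal_mul (abs_nonneg _)]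
    congr 1
    rw [sliceDensity, det_spatialComp_transition g t hx.2 (h1 hx.1), Real.sqrt_mul (sq_nonneg _),
      Real.sqrt_sq_eq_abs]
    rfl
  · intro a ha b hb hab
    have := (extChartAt (𝓡 n) m₁).injOn (h1 ha.1) (h1 hb.1) hab
    exact (extChartAt (𝓡 n) m₀).symm.injOn ha.2 hb.2 this

omit [IsManifold (𝓡 n) ∞ M] in
theorem chartVolume_compl_source (m₀ : M) : chartVolume g t m₀ (extChartAt (𝓡 n) m₀).sourceᶜ = 0 := by
  rw [chartVolume_apply g t m₀ (isOpen_extChartAt_source m₀).measurableSet.compl]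
  have : (extChartAt (𝓡 n) m₀).symm ⁻¹' (extChartAt (𝓡 n) m₀).sourceᶜ ∩
      (extChartAt (𝓡 n) m₀).target = ∅ :=
    Set.eq_empty_of_forall_notMem fun x hx => hx.1 ((extChartAt (𝓡 n) m₀).map_target hx.2)
  rw [this, Measure.restrict_empty, lintegral_zero_measure]

/-- On a chart domain the volume measure of the slice is the volume measure of the chart. -/
theorem sliceVolume_restrict_source (m₀ : M) :
    (sliceVolume g t).restrict (extChartAt (𝓡 n) m₀).source = chartVolume g t m₀ := by
  have hU := (isOpen_extChartAt_source (I := 𝓡 n) m₀).measurableSet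
  have hres : ∀ A : Set M, chartVolume g t m₀ A =
      chartVolume g t m₀ (A ∩ (extChartAt (𝓡 n) m₀).source) := fun A =>
    (measure_inter_conull (chartVolume_compl_source g t m₀)).symm
  apply le_antisymm
  -- As `sliceVolume` is a least upper bound, it lies below any measure dominating every chart
  -- volume. The one chosen agrees with the chart volume on the chart domain and is the slice volume
  -- itself outside.
  · have hle : sliceVolume g t ≤ chartVolume g t m₀ +
        (sliceVolume g t).restrict (extChartAt (𝓡 n) m₀).sourceᶜ := by
      refine iSup_le fun m₁ => Measure.le_iff.2 fun A hA => ?_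
      have hV := (isOpen_extChartAt_source (I := 𝓡 n) m₁).measurableSet
      rw [← measure_inter_add_sdiff A hU, Measure.add_apply, Measure.restrict_apply hA]
      refine add_le_add ?_ (Measure.le_iff'.1 (le_iSup (chartVolume g t) m₁) _)
      calc chartVolume g t m₁ (A ∩ (extChartAt (𝓡 n) m₀).source)
          = chartVolume g t m₁ (A ∩ (extChartAt (𝓡 n) m₀).source ∩ (extChartAt (𝓡 n) m₁).source) :=
            (measure_inter_conull (chartVolume_compl_source g t m₁)).symm
        _ = chartVolume g t m₀
              (A ∩ (extChartAt (𝓡 n) m₀).source ∩ (extChartAt (𝓡 n) m₁).source) :=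
            chartVolume_eq_of_subset g t ((hA.inter hU).inter hV) Set.inter_subset_right
              (Set.inter_subset_left.trans Set.inter_subset_right)
        _ ≤ chartVolume g t m₀ A :=
            measure_mono (Set.inter_subset_left.trans Set.inter_subset_left)
    refine Measure.le_iff.2 fun A hA => ?_
    rw [Measure.restrict_apply hA]
    refine (Measure.le_iff'.1 hle _).trans ?_
    rw [Measure.add_apply, Measure.restrict_apply (hA.inter hU), Set.inter_assoc,
      Set.inter_compl_self, Set.inter_empty, measure_empty, add_zero]
    exact measure_mono Set.inter_subset_left
  · refine Measure.le_iff.2 fun A hA => ?_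
    rw [Measure.restrict_apply hA, hres A]
    exact Measure.le_iff'.1 (le_iSup (chartVolume g t) m₀) _

/-- Near each point the volume density is bounded on a compact coordinate neighbourhood. This is
what makes continuous functions with compact support integrable over a slice. -/
theorem isLocallyFiniteMeasure_sliceVolume : IsLocallyFiniteMeasure (sliceVolume (n := n) g t) := by
  refine ⟨fun m => ?_⟩
  have hx := mem_extChartAt_target (I := 𝓡 n) m
  obtain ⟨K, hK, hxK, hKt⟩ := exists_compact_subset (isOpen_extChartAt_target (I := 𝓡 n) m) hx
  set A := (extChartAt (𝓡 n) m).source ∩ extChartAt (𝓡 n) m ⁻¹' interior K with hA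
  have hAo : IsOpen A :=
    (continuousOn_extChartAt m).isOpen_inter_preimage (isOpen_extChartAt_source m) isOpen_interior
  refine ⟨A, hAo.mem_nhds ⟨mem_extChartAt_source m, hxK⟩, ?_⟩
  have h1 : sliceVolume g t A = chartVolume g t m A := by
    rw [← sliceVolume_restrict_source g t m, Measure.restrict_apply hAo.measurableSet,
      Set.inter_eq_left.2 Set.inter_subset_left]
  rw [h1, chartVolume_apply g t m hAo.measurableSet]
  have hsub : (extChartAt (𝓡 n) m).symm ⁻¹' A ∩ (extChartAt (𝓡 n) m).target ⊆ K := by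
    rintro z ⟨hz, hz'⟩
    have := interior_subset hz.2
    rwa [(extChartAt (𝓡 n) m).right_inv hz'] at this
  refine (lintegral_mono_set hsub).trans_lt ?_
  obtain ⟨C, hC⟩ := hK.bddAbove_image ((continuousOn_sliceDensity g t m).mono hKt)
  calc ∫⁻ x in K, ENNReal.ofReal (sliceDensity g t m x) ≤ ∫⁻ _ in K, ENNReal.ofReal C :=
        setLIntegral_mono measurable_const fun x hx =>
          ENNReal.ofReal_le_ofReal (hC (Set.mem_image_of_mem _ hx))
    _ < ⊤ := by
        rw [setLIntegral_const]
        exact ENNReal.mul_lt_top ENNReal.ofReal_lt_top hK.measure_lt_top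

/-- Integrals over a slice of functions supported in a chart domain. -/
theorem integral_sliceVolume_of_support_subset (m₀ : M) {f : M → ℝ} (hf : Continuous f)
    (hs : Function.support f ⊆ (extChartAt (𝓡 n) m₀).source) :
    ∫ m, f m ∂(sliceVolume g t) = ∫ x in (extChartAt (𝓡 n) m₀).target,
      sliceDensity g t m₀ x * f ((extChartAt (𝓡 n) m₀).symm x) := by
  rw [← setIntegral_eq_integral_of_forall_compl_eq_zero (s := (extChartAt (𝓡 n) m₀).source)
    fun x hx => Function.notMem_support.1 fun h => hx (hs h), sliceVolume_restrict_source,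
    chartVolume_eq_map, integral_map (aemeasurable_extChartAt_symm_withDensity g t m₀)
      hf.aestronglyMeasurable]
  have hT := (isOpen_extChartAt_target (I := 𝓡 n) m₀).measurableSet
  rw [integral_withDensity_eq_integral_toReal_smul₀
    ((continuousOn_sliceDensity g t m₀).aemeasurable₀ hT.nullMeasurableSet).ennreal_ofReal
    (Filter.Eventually.of_forall fun x => ENNReal.ofReal_lt_top)]
  refine integral_congr_ae (Filter.Eventually.of_forall fun x => ?_)
  change (ENNReal.ofReal (sliceDensity g t m₀ x)).toReal • _ = _
  rw [ENNReal.toReal_ofReal (r := sliceDensity g t m₀ x) (Real.sqrt_nonneg _), smul_eq_mul]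

end SliceVolume

/-! ### The continuity equation in coordinates. -/

section Conservation

variable {Ω : Set (EuclideanSpace ℝ (Fin n))} {χ : EuclideanSpace ℝ (Fin n) → ℝ}

/-- `w` is controlled only over `Ω`, but near points outside the closed support of `χ` the product
is locally zero, so it is smooth everywhere. -/
theorem contDiff_cutoff_mul (hΩ : IsOpen Ω) {w : Vec n → ℝ}
    (hw : ContDiffOn ℝ ∞ w (Ω ×ˢ Set.univ)) (hχ : ContDiff ℝ ∞ χ) (hs : tsupport χ ⊆ Ω) :
    ContDiff ℝ ∞ (fun y : Vec n => χ y.1 * w y) := by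
  rw [contDiff_iff_contDiffAt]
  intro y
  by_cases hy : y.1 ∈ tsupport χ
  · exact (hχ.comp contDiff_fst).contDiffAt.mul
      (hw.contDiffAt ((hΩ.prod isOpen_univ).mem_nhds ⟨hs hy, Set.mem_univ _⟩))
  · have h0 : χ =ᶠ[𝓝 y.1] 0 := notMem_tsupport_iff_eventuallyEq.1 hy
    refine (contDiffAt_const (c := (0 : ℝ))).congr_of_eventuallyEq ?_
    filter_upwards [continuous_fst.continuousAt.eventually h0] with z hz
    rw [hz, Pi.zero_apply, zero_mul]

/-- Integration by parts against the constant `1`; it removes the spatial part of the divergence. -/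
theorem integral_fderiv_eq_zero {f : EuclideanSpace ℝ (Fin n) → ℝ} (hf : ContDiff ℝ ∞ f)
    (hc : HasCompactSupport f) (v : EuclideanSpace ℝ (Fin n)) : ∫ x, fderiv ℝ f x v = 0 := by
  have hi : Integrable (fun x => fderiv ℝ f x v) :=
    ((hf.continuous_fderiv (by simp)).clm_apply continuous_const).integrable_of_hasCompactSupport
      (hc.fderiv_apply (𝕜 := ℝ) v)
  have := integral_mul_fderiv_eq_neg_fderiv_mul_of_integrable (μ := volume) (𝕜 := ℝ)
    (f := fun _ : EuclideanSpace ℝ (Fin n) => (1 : ℝ)) (g := f) (v := v) (by simp)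
    (by simpa using hi) (by simpa using hf.continuous.integrable_of_hasCompactSupport hc)
    (fun x _ => by fun_prop) (fun x _ => hf.differentiable (by simp) x)
  simpa using this

/-- Over a bounded time interval only the compact set `K ×ˢ Set.uIcc t₀ t₁` contributes. This
justifies exchanging the space and time integrals. -/
theorem integrable_of_continuous_of_fst {K : Set (EuclideanSpace ℝ (Fin n))} (hK : IsCompact K)
    {D : Vec n → ℝ} (hD : Continuous D) (h0 : ∀ y : Vec n, y.1 ∉ K → D y = 0) (t₀ t₁ : ℝ) :
    Integrable D ((volume : Measure (EuclideanSpace ℝ (Fin n))).prod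
      ((volume : Measure ℝ).restrict (Set.uIoc t₀ t₁))) := by
  rw [← Measure.restrict_univ (μ := (volume : Measure (EuclideanSpace ℝ (Fin n)))),
    Measure.prod_restrict]
  have h1 : IntegrableOn D (K ×ˢ Set.uIcc t₀ t₁)
      ((volume : Measure (EuclideanSpace ℝ (Fin n))).prod (volume : Measure ℝ)) :=
    hD.continuousOn.integrableOn_compact (hK.prod isCompact_uIcc)
  refine IntegrableOn.of_forall_sdiff_eq_zero h1 (MeasurableSet.univ.prod measurableSet_uIoc) ?_
  rintro y ⟨⟨-, hy⟩, hy'⟩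
  exact h0 y fun hK' => hy' ⟨hK', Set.uIoc_subset_uIcc hy⟩

theorem pd_inl {f : Vec n → ℝ} {x : EuclideanSpace ℝ (Fin n)} {t : ℝ}
    (hf : DifferentiableAt ℝ f (x, t)) (i : Fin n) :
    fderiv ℝ (fun z => f (z, t)) x (EuclideanSpace.single i 1) = pd (Sum.inl i) f (x, t) := by
  have h : HasFDerivAt (fun z : EuclideanSpace ℝ (Fin n) => ((z, t) : Vec n))
      (ContinuousLinearMap.inl ℝ _ ℝ) x := hasFDerivAt_prodMk_left x t
  have h2 : HasFDerivAt (fun z => f (z, t)) _ x := hf.hasFDerivAt.comp x h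
  rw [h2.fderiv]
  rfl

theorem hasDerivAt_pd_inr {f : Vec n → ℝ} {x : EuclideanSpace ℝ (Fin n)} {t : ℝ}
    (hf : DifferentiableAt ℝ f (x, t)) :
    HasDerivAt (fun s => f (x, s)) (pd (Sum.inr ()) f (x, t)) t := by
  have h : HasDerivAt (fun s : ℝ => ((x, s) : Vec n)) (0, 1) t :=
    (hasDerivAt_const t x).prodMk (hasDerivAt_id t)
  exact hf.hasFDerivAt.comp_hasDerivAt t h

variable {W : Idx n → Vec n → ℝ}

/-- The flux integrand of a vector density through the level sets of `χ`. -/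
def fluxIntegrand (χ : EuclideanSpace ℝ (Fin n) → ℝ) (W : Idx n → Vec n → ℝ) (y : Vec n) : ℝ :=
  ∑ i : Fin n, fderiv ℝ χ y.1 (EuclideanSpace.single i 1) * W (Sum.inl i) y

theorem continuous_fluxIntegrand (hΩ : IsOpen Ω)
    (hW : ∀ i, ContDiffOn ℝ ∞ (W i) (Ω ×ˢ Set.univ)) (hχ : ContDiff ℝ ∞ χ)
    (hs : tsupport χ ⊆ Ω) : Continuous (fluxIntegrand χ W) :=
  continuous_finsetSum _ fun i _ => (contDiff_cutoff_mul hΩ (hW (Sum.inl i))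
    ((hχ.fderiv_right (m := ∞) (by simp)).clm_apply contDiff_const)
    ((tsupport_fderiv_apply_subset ℝ _).trans hs)).continuous

theorem fluxIntegrand_eq_zero {y : Vec n} (hy : y.1 ∉ tsupport χ) : fluxIntegrand χ W y = 0 := by
  refine Finset.sum_eq_zero fun i _ => ?_
  have : fderiv ℝ χ y.1 = 0 := by
    by_contra h
    exact hy (support_fderiv_subset ℝ h)
  rw [this, zero_apply, zero_mul]

/-- In the product rule `χ` times the divergence drops out, and the derivative of `χ` has no time
component because `χ` depends on space only. -/
theorem sum_pd_cutoff_mul (hΩ : IsOpen Ω) (hW : ∀ i, ContDiffOn ℝ ∞ (W i) (Ω ×ˢ Set.univ))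
    (hdiv : ∀ y ∈ Ω ×ˢ (Set.univ : Set ℝ), ∑ i, pd i (W i) y = 0) (hχ : ContDiff ℝ ∞ χ)
    (hs : tsupport χ ⊆ Ω) (y : Vec n) :
    ∑ i, pd i (fun z : Vec n => χ z.1 * W i z) y = fluxIntegrand χ W y := by
  by_cases hy : y.1 ∈ tsupport χ
  · have hyΩ : y ∈ Ω ×ˢ (Set.univ : Set ℝ) := ⟨hs hy, Set.mem_univ _⟩
    have hdχ : HasFDerivAt (fun z : Vec n => χ z.1) ((fderiv ℝ χ y.1).comp
        (ContinuousLinearMap.fst ℝ (EuclideanSpace ℝ (Fin n)) ℝ)) y :=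
      (hχ.differentiable (by simp) y.1).hasFDerivAt.comp y hasFDerivAt_fst
    have hp : ∀ i, pd i (fun z : Vec n => χ z.1) y = fderiv ℝ χ y.1 (stdVec i : Vec n).1 := by
      intro i
      rw [pd, hdχ.fderiv]
      rfl
    simp only [pd_mul hdχ.differentiableAt (((hW _).contDiffAt
      ((hΩ.prod isOpen_univ).mem_nhds hyΩ)).differentiableAt (by simp)), hp,
      Finset.sum_add_distrib, ← Finset.mul_sum, hdiv y hyΩ, mul_zero, add_zero]
    simp [stdVec, fluxIntegrand]
  · rw [fluxIntegrand_eq_zero hy]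
    refine Finset.sum_eq_zero fun i _ => ?_
    have h0 : χ =ᶠ[𝓝 y.1] 0 := notMem_tsupport_iff_eventuallyEq.1 hy
    have h1 : (fun z : Vec n => χ z.1 * W i z) =ᶠ[𝓝 y] fun _ => 0 := by
      filter_upwards [continuous_fst.continuousAt.eventually h0] with z hz
      rw [hz, Pi.zero_apply, zero_mul]
    rw [pd, h1.fderiv_eq, fderiv_fun_const, Pi.zero_apply, zero_apply]

/-- The integrated continuity equation for a divergence free vector density on `Ω × ℝ`, tested
against a function with compact support in `Ω`. -/
theorem integral_continuity_equation (hΩ : IsOpen Ω)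
    (hW : ∀ i, ContDiffOn ℝ ∞ (W i) (Ω ×ˢ Set.univ))
    (hdiv : ∀ y ∈ Ω ×ˢ (Set.univ : Set ℝ), ∑ i, pd i (W i) y = 0) (hχ : ContDiff ℝ ∞ χ)
    (hc : HasCompactSupport χ) (hs : tsupport χ ⊆ Ω) (t₀ t₁ : ℝ) :
    (∫ x, χ x * W (Sum.inr ()) (x, t₁)) - ∫ x, χ x * W (Sum.inr ()) (x, t₀) =
      ∫ t in t₀..t₁, ∫ x, fluxIntegrand χ W (x, t) := by
  have hF := fun i => contDiff_cutoff_mul hΩ (hW i) hχ hs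
  have hFd := fun i => (hF i).differentiable (by simp)
  set F : Idx n → Vec n → ℝ := fun i z => χ z.1 * W i z with hFdef
  have hpc : ∀ i, Continuous (pd i (F i)) := fun i =>
    ((hF i).continuous_fderiv (by simp)).clm_apply continuous_const
  have hslice : ∀ i t, HasCompactSupport fun x => F i (x, t) := fun i t =>
    hc.mul_right (f' := fun x => W i (x, t))
  have hsliceD : ∀ i t, ContDiff ℝ ∞ fun x => F i (x, t) := fun i t =>
    (hF i).comp (contDiff_id.prodMk contDiff_const)
  have hint : ∀ t, Integrable fun x => F (Sum.inr ()) (x, t) := fun t =>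
    (hsliceD _ t).continuous.integrable_of_hasCompactSupport (hslice _ t)
  have hpz : ∀ i, ∀ y : Vec n, y.1 ∉ tsupport χ → pd i (F i) y = 0 := by
    intro i y hy
    have h0 : χ =ᶠ[𝓝 y.1] 0 := notMem_tsupport_iff_eventuallyEq.1 hy
    have h1 : F i =ᶠ[𝓝 y] fun _ => 0 := by
      filter_upwards [continuous_fst.continuousAt.eventually h0] with z hz
      rw [hFdef]
      change χ z.1 * _ = 0
      rw [hz, Pi.zero_apply, zero_mul]
    rw [pd, h1.fderiv_eq, fderiv_fun_const, Pi.zero_apply, zero_apply]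
  have hFTC : ∀ x, F (Sum.inr ()) (x, t₁) - F (Sum.inr ()) (x, t₀) =
      ∫ t in t₀..t₁, pd (Sum.inr ()) (F (Sum.inr ())) (x, t) := fun x =>
    (intervalIntegral.integral_eq_sub_of_hasDerivAt
      (fun t _ => hasDerivAt_pd_inr (hFd (Sum.inr ()) (x, t)))
      (((hpc (Sum.inr ())).comp (by fun_prop : Continuous fun t : ℝ =>
        ((x, t) : Vec n))).intervalIntegrable _ _)).symm
  have hsp : ∀ i : Fin n, ∀ t, Integrable (fun x => pd (Sum.inl i) (F (Sum.inl i)) (x, t)) ∧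
      ∫ x, pd (Sum.inl i) (F (Sum.inl i)) (x, t) = 0 := by
    intro i t
    have e : (fun x => pd (Sum.inl i) (F (Sum.inl i)) (x, t)) = fun x =>
        fderiv ℝ (fun z => F (Sum.inl i) (z, t)) x (EuclideanSpace.single i 1) :=
      funext fun x => (pd_inl (hFd _ _) i).symm
    constructor
    · rw [e]
      exact (((hsliceD _ t).continuous_fderiv (by simp)).clm_apply
        continuous_const).integrable_of_hasCompactSupport ((hslice _ t).fderiv_apply (𝕜 := ℝ) _)
    · rw [e]
      exact integral_fderiv_eq_zero (hsliceD _ t) (hslice _ t) _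
  have hHint : ∀ t, Integrable fun x => fluxIntegrand χ W (x, t) := fun t =>
    ((continuous_fluxIntegrand hΩ hW hχ hs).comp (by fun_prop : Continuous
      fun x : EuclideanSpace ℝ (Fin n) => ((x, t) : Vec n))).integrable_of_hasCompactSupport
        (HasCompactSupport.intro hc fun x hx => fluxIntegrand_eq_zero hx)
  rw [← integral_sub (hint t₁) (hint t₀)]
  simp only [hFTC]
  rw [← intervalIntegral_integral_swap]
  · refine intervalIntegral.integral_congr fun t _ => ?_
    -- The time derivative is the flux minus spatial derivatives, and the latter integrate to zero
    -- by `hsp`.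
    have e : ∀ x, pd (Sum.inr ()) (F (Sum.inr ())) (x, t) = fluxIntegrand χ W (x, t) -
        ∑ i : Fin n, pd (Sum.inl i) (F (Sum.inl i)) (x, t) := by
      intro x
      rw [← sum_pd_cutoff_mul hΩ hW hdiv hχ hs, Fintype.sum_sum_type]
      simp [hFdef]
    simp only [e]
    rw [integral_sub (hHint t) (integrable_finsetSum _ fun i _ => (hsp i t).1),
      integral_finsetSum _ fun i _ => (hsp i t).1, Finset.sum_eq_zero fun i _ => (hsp i t).2,
      sub_zero]
  · exact (integrable_of_continuous_of_fst hc (hpc _) (hpz _) t₀ t₁).swap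

/-- Continuity in time provides the interval integrability needed to add balances in the partition
of unity argument. -/
theorem continuous_integral_fluxIntegrand (hΩ : IsOpen Ω)
    (hW : ∀ i, ContDiffOn ℝ ∞ (W i) (Ω ×ˢ Set.univ)) (hχ : ContDiff ℝ ∞ χ)
    (hc : HasCompactSupport χ) (hs : tsupport χ ⊆ Ω) :
    Continuous fun t : ℝ => ∫ x, fluxIntegrand χ W (x, t) := by
  have h : ∀ t : ℝ, ∫ x, fluxIntegrand χ W (x, t) =
      ∫ x in tsupport χ, fluxIntegrand χ W (x, t) := fun t =>
    (setIntegral_eq_integral_of_forall_compl_eq_zero fun x hx => fluxIntegrand_eq_zero hx).symm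
  simp only [h]
  refine continuous_parametric_integral_of_continuous ?_ hc
  exact (continuous_fluxIntegrand hΩ hW hχ hs).comp (by fun_prop : Continuous
    fun q : ℝ × EuclideanSpace ℝ (Fin n) => ((q.2, q.1) : Vec n))

end Conservation

/-! ### The integrated continuity equation on `M`. -/

section Global

variable [IsManifold (𝓡 n) ∞ M] (g : SpacetimeMetric n M) {X : VField n M} {T : Tensor2 n M}

omit [IsManifold (𝓡 n) ∞ M] in
theorem continuousOn_slice {w : Vec n → ℝ} {m₀ : M}
    (hw : ContDiffOn ℝ ∞ w (extChartAt (𝓘st n) (m₀, (0 : ℝ))).target) (t : ℝ) :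
    ContinuousOn (fun x => w (x, t)) (extChartAt (𝓡 n) m₀).target :=
  hw.continuousOn.comp (by fun_prop) fun _ hx => mem_target_spacetime 0 hx t

/-- A function on a slice is continuous if its densitized versions in the charts are. -/
theorem continuous_of_sliceDensity_mul (t : ℝ) {f : M → ℝ}
    (h : ∀ m₀ : M, ContinuousOn (fun x => sliceDensity g t m₀ x * f ((extChartAt (𝓡 n) m₀).symm x))
      (extChartAt (𝓡 n) m₀).target) : Continuous f := by
  rw [continuous_iff_continuousAt]
  intro m₀
  have h1 : ContinuousOn (fun m => (sliceDensity g t m₀ (extChartAt (𝓡 n) m₀ m) *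
      f ((extChartAt (𝓡 n) m₀).symm (extChartAt (𝓡 n) m₀ m))) /
        sliceDensity g t m₀ (extChartAt (𝓡 n) m₀ m)) (extChartAt (𝓡 n) m₀).source :=
    ((h m₀).div (continuousOn_sliceDensity g t m₀) fun x hx => (sliceDensity_pos g t hx).ne').comp
      (continuousOn_extChartAt m₀) (extChartAt (𝓡 n) m₀).mapsTo
  have h2 : ContinuousOn f (extChartAt (𝓡 n) m₀).source := by
    refine h1.congr fun m hm => ?_
    change f m = _ * _ / _
    rw [mul_div_cancel_left₀ _ (sliceDensity_pos g t ((extChartAt (𝓡 n) m₀).map_source hm)).ne',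
      (extChartAt (𝓡 n) m₀).left_inv hm]
  exact h2.continuousAt ((isOpen_extChartAt_source m₀).mem_nhds (mem_extChartAt_source m₀))

theorem continuous_energyDensity (hX : X.Smooth) (hT : T.Smooth) (hTs : T.Symm) (t : ℝ) :
    Continuous (energyDensity g X T t) :=
  continuous_of_sliceDensity_mul g t fun m₀ =>
    ((continuousOn_slice (contDiffOn_volDensity g (m₀, 0)) t).mul
      (continuousOn_slice (contDiffOn_energyMomentumComp g (m₀, 0) hX hT (Sum.inr ())) t)).congr
        fun _ hx => sqrt_det_mul_energyDensity g X hTs hx t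

/-- The flux `lapse · P^α ∂_α f` of the energy-momentum vector through the level sets of a function
`f` on `M`. -/
def levelFlux (g : SpacetimeMetric n M) (X : VField n M) (T : Tensor2 n M) (f : M → ℝ) (t : ℝ)
    (m : M) : ℝ :=
  lapse g (m, t) *
    dScalar (n := n) (fun q : M × ℝ => f q.1) (m, t) (energyMomentum g X T (m, t))

variable {f : M → ℝ}

theorem continuous_levelFlux (hX : X.Smooth) (hT : T.Smooth) (hTs : T.Symm)
    (hf : ContMDiff (𝓡 n) 𝓘(ℝ, ℝ) ∞ f) (t : ℝ) : Continuous (levelFlux g X T f t) := by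
  refine continuous_of_sliceDensity_mul g t fun m₀ => ContinuousOn.congr ?_
    fun x hx => sqrt_det_mul_lapse_mul_dScalar g X hTs hf hx t
  have hfs : ContDiffOn ℝ ∞ (f ∘ (extChartAt (𝓡 n) m₀).symm) (extChartAt (𝓡 n) m₀).target := by
    rw [← contMDiffOn_iff_contDiffOn]
    exact hf.comp_contMDiffOn (contMDiffOn_extChartAt_symm m₀)
  refine continuousOn_finsetSum _ fun i _ => ContinuousOn.mul ?_
    ((continuousOn_slice (contDiffOn_volDensity g (m₀, 0)) t).mul
      (continuousOn_slice (contDiffOn_energyMomentumComp g (m₀, 0) hX hT (Sum.inl i)) t))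
  exact (hfs.continuousOn_fderiv_of_isOpen (isOpen_extChartAt_target m₀) (by simp)).clm_apply
    continuousOn_const

omit [IsManifold (𝓡 n) ∞ M] in
theorem levelFlux_congr {f' : M → ℝ} {m : M} (h : f =ᶠ[𝓝 m] f') (t : ℝ) :
    levelFlux g X T f t m = levelFlux g X T f' t m := by
  have h1 : (fun q : M × ℝ => f q.1) =ᶠ[𝓝 (m, t)] fun q => f' q.1 :=
    (continuous_fst.continuousAt (x := (m, t))).eventually h
  rw [levelFlux, levelFlux, dScalar, dScalar, h1.mfderiv_eq]

omit [IsManifold (𝓡 n) ∞ M] in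
theorem levelFlux_const (c : ℝ) (t : ℝ) (m : M) : levelFlux g X T (fun _ => c) t m = 0 := by
  rw [levelFlux, dScalar, mfderiv_const]
  exact mul_zero _

omit [IsManifold (𝓡 n) ∞ M] in
theorem levelFlux_add {f' : M → ℝ} (hf : ContMDiff (𝓡 n) 𝓘(ℝ, ℝ) ∞ f)
    (hf' : ContMDiff (𝓡 n) 𝓘(ℝ, ℝ) ∞ f') (t : ℝ) (m : M) :
    levelFlux g X T (f + f') t m = levelFlux g X T f t m + levelFlux g X T f' t m := by
  have h := mfderiv_add ((dScalar_comp_fst hf).mdifferentiable (by simp) (m, t))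
    ((dScalar_comp_fst hf').mdifferentiable (by simp) (m, t))
  rw [levelFlux, levelFlux, levelFlux, ← mul_add]
  exact congrArg (fun (A : Vec n →L[ℝ] ℝ) => lapse g (m, t) * A (energyMomentum g X T (m, t))) h

omit [IsManifold (𝓡 n) ∞ M] in
theorem levelFlux_comp (hf : ContMDiff (𝓡 n) 𝓘(ℝ, ℝ) ∞ f) {θ : ℝ → ℝ} (hθ : Differentiable ℝ θ)
    (t : ℝ) (m : M) :
    levelFlux g X T (θ ∘ f) t m = deriv θ (f m) * levelFlux g X T f t m := by
  have h : HasMFDerivAt (𝓘st n) 𝓘(ℝ, ℝ) (θ ∘ fun q : M × ℝ => f q.1) (m, t) _ :=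
    ((hθ (f m)).hasFDerivAt.hasMFDerivAt).comp (m, t)
      ((dScalar_comp_fst hf).mdifferentiable (by simp) (m, t)).hasMFDerivAt
  have h2 : dScalar (n := n) (fun q : M × ℝ => (θ ∘ f) q.1) (m, t)
      (energyMomentum g X T (m, t)) = fderiv ℝ θ (f m)
        (dScalar (n := n) (fun q : M × ℝ => f q.1) (m, t) (energyMomentum g X T (m, t))) :=
    congrArg (fun (A : Vec n →L[ℝ] ℝ) => A (energyMomentum g X T (m, t))) h.mfderiv
  rw [levelFlux, h2, levelFlux, fderiv_eq_smul_deriv, smul_eq_mul]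
  ring

omit [IsManifold (𝓡 n) ∞ M] in
theorem support_levelFlux_subset (f : M → ℝ) (t : ℝ) :
    Function.support (levelFlux g X T f t) ⊆ tsupport f := by
  intro m hm
  by_contra h
  exact hm ((levelFlux_congr g (notMem_tsupport_iff_eventuallyEq.1 h) t).trans
    (levelFlux_const g 0 t m))

section Pushforward

variable (m₀ : M)

/-- A function on `M` in the chart at `m₀`, extended by zero. -/
def inChart (f : M → ℝ) : EuclideanSpace ℝ (Fin n) → ℝ :=
  (extChartAt (𝓡 n) m₀).target.indicator (f ∘ (extChartAt (𝓡 n) m₀).symm)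

variable {m₀}

omit [IsManifold (𝓡 n) ∞ M] in
-- The image of the compact support is compact, hence closed in all of `ℝⁿ`. The extension by zero
-- therefore has closed support inside the chart target and stays smooth across its boundary.
theorem tsupport_inChart_subset (hc : HasCompactSupport f)
    (hs : tsupport f ⊆ (extChartAt (𝓡 n) m₀).source) :
    IsCompact (extChartAt (𝓡 n) m₀ '' tsupport f) ∧
      tsupport (inChart (n := n) m₀ f) ⊆ extChartAt (𝓡 n) m₀ '' tsupport f := by
  have hK : IsCompact (extChartAt (𝓡 n) m₀ '' tsupport f) :=
    IsCompact.image_of_continuousOn hc ((continuousOn_extChartAt m₀).mono hs)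
  refine ⟨hK, closure_minimal (fun x hx => ?_) hK.isClosed⟩
  have hxt : x ∈ (extChartAt (𝓡 n) m₀).target := Set.mem_of_indicator_ne_zero hx
  refine ⟨(extChartAt (𝓡 n) m₀).symm x, subset_tsupport f fun h => hx ?_,
    (extChartAt (𝓡 n) m₀).right_inv hxt⟩
  rw [inChart, Set.indicator_of_mem hxt]
  exact h

omit [IsManifold (𝓡 n) ∞ M] in
theorem tsupport_inChart_subset_target (hc : HasCompactSupport f)
    (hs : tsupport f ⊆ (extChartAt (𝓡 n) m₀).source) :
    tsupport (inChart (n := n) m₀ f) ⊆ (extChartAt (𝓡 n) m₀).target := by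
  refine (tsupport_inChart_subset hc hs).2.trans ?_
  rintro _ ⟨m, hm, rfl⟩
  exact (extChartAt (𝓡 n) m₀).map_source (hs hm)

omit [IsManifold (𝓡 n) ∞ M] in
theorem hasCompactSupport_inChart (hc : HasCompactSupport f)
    (hs : tsupport f ⊆ (extChartAt (𝓡 n) m₀).source) :
    HasCompactSupport (inChart (n := n) m₀ f) :=
  (tsupport_inChart_subset hc hs).1.of_isClosed_subset (isClosed_tsupport _)
    (tsupport_inChart_subset hc hs).2

omit [IsManifold (𝓡 n) ∞ M] in
theorem inChart_eventuallyEq {x : EuclideanSpace ℝ (Fin n)}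
    (hx : x ∈ (extChartAt (𝓡 n) m₀).target) (f : M → ℝ) :
    inChart m₀ f =ᶠ[𝓝 x] f ∘ (extChartAt (𝓡 n) m₀).symm := by
  filter_upwards [(isOpen_extChartAt_target m₀).mem_nhds hx] with z hz
  exact Set.indicator_of_mem hz _

theorem contDiff_inChart (hf : ContMDiff (𝓡 n) 𝓘(ℝ, ℝ) ∞ f) (hc : HasCompactSupport f)
    (hs : tsupport f ⊆ (extChartAt (𝓡 n) m₀).source) :
    ContDiff ℝ ∞ (inChart (n := n) m₀ f) := by
  have hfs : ContDiffOn ℝ ∞ (f ∘ (extChartAt (𝓡 n) m₀).symm) (extChartAt (𝓡 n) m₀).target := by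
    rw [← contMDiffOn_iff_contDiffOn]
    exact hf.comp_contMDiffOn (contMDiffOn_extChartAt_symm m₀)
  rw [contDiff_iff_contDiffAt]
  intro x
  by_cases hx : x ∈ (extChartAt (𝓡 n) m₀).target
  · exact (hfs.contDiffAt ((isOpen_extChartAt_target m₀).mem_nhds hx)).congr_of_eventuallyEq
      (inChart_eventuallyEq hx f)
  · exact (contDiffAt_const (c := (0 : ℝ))).congr_of_eventuallyEq (notMem_tsupport_iff_eventuallyEq.1
      fun h => hx (tsupport_inChart_subset_target hc hs h))

end Pushforward

variable [MeasurableSpace M] [BorelSpace M]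

/-- The integrated continuity equation of the energy-momentum vector, tested against `f`. -/
def IntegralBalance (g : SpacetimeMetric n M) (X : VField n M) (T : Tensor2 n M) (t₀ t₁ : ℝ)
    (f : M → ℝ) : Prop :=
  (∫ m, f m * energyDensity g X T t₁ m ∂(sliceVolume g t₁)) -
      ∫ m, f m * energyDensity g X T t₀ m ∂(sliceVolume g t₀) =
    ∫ t in t₀..t₁, ∫ m, levelFlux g X T f t m ∂(sliceVolume g t)

/-- In the chart, multiplication by `√det h` turns the energy density into `W^t` and the level flux
into `∑ ∂_i χ W^i`, where `W^i = √|det g| P^i` is divergence free. The coordinate continuity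
equation then applies. -/
theorem integralBalance_of_tsupport_subset (hX : X.Smooth) (hK : IsKilling g X) (hT : T.Smooth)
    (hTs : T.Symm) (hTc : IsConserved g T) (t₀ t₁ : ℝ) {m₀ : M}
    (hf : ContMDiff (𝓡 n) 𝓘(ℝ, ℝ) ∞ f) (hc : HasCompactSupport f)
    (hs : tsupport f ⊆ (extChartAt (𝓡 n) m₀).source) :
    IntegralBalance g X T t₀ t₁ f ∧
      Continuous fun t => ∫ m, levelFlux g X T f t m ∂(sliceVolume g t) := by
  set W : Idx n → Vec n → ℝ := fun i y =>
    volDensity g (m₀, 0) y * energyMomentumComp g X T (m₀, 0) i y with hWdef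
  have htar : (extChartAt (𝓘st n) (m₀, (0 : ℝ))).target =
      (extChartAt (𝓡 n) m₀).target ×ˢ Set.univ := by
    rw [extChartAt_spacetime]
    rfl
  have hΩ := isOpen_extChartAt_target (I := 𝓡 n) m₀
  have hW : ∀ i, ContDiffOn ℝ ∞ (W i) ((extChartAt (𝓡 n) m₀).target ×ˢ Set.univ) := fun i => by
    rw [← htar]
    exact (contDiffOn_volDensity g _).mul (contDiffOn_energyMomentumComp g _ hX hT i)
  have hdiv : ∀ y ∈ (extChartAt (𝓡 n) m₀).target ×ˢ (Set.univ : Set ℝ), ∑ i, pd i (W i) y = 0 := by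
    intro y hy
    rw [← htar] at hy
    exact sum_pd_volDensity_mul_energyMomentumComp g (m₀, 0) hX hK hT hTs hTc hy
  have hχ := contDiff_inChart hf hc hs
  have hχc := hasCompactSupport_inChart hc hs
  have hχs := tsupport_inChart_subset_target hc hs
  have hρ : ∀ t, ∫ m, f m * energyDensity g X T t m ∂(sliceVolume g t) =
      ∫ x, inChart m₀ f x * W (Sum.inr ()) (x, t) := by
    intro t
    have e : ∫ x in (extChartAt (𝓡 n) m₀).target, inChart m₀ f x * W (Sum.inr ()) (x, t) =
        ∫ x, inChart m₀ f x * W (Sum.inr ()) (x, t) :=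
      setIntegral_eq_integral_of_forall_compl_eq_zero fun x hx => by
        rw [inChart, Set.indicator_of_notMem hx, zero_mul]
    rw [integral_sliceVolume_of_support_subset g t m₀ (f := fun m => f m * energyDensity g X T t m)
      (hf.continuous.mul (continuous_energyDensity g hX hT hTs t))
      (((Function.support_mul_subset_left _ _).trans (subset_tsupport f)).trans hs), ← e]
    refine setIntegral_congr_fun hΩ.measurableSet fun x hx => ?_
    have := sqrt_det_mul_energyDensity g X hTs hx t
    change sliceDensity g t m₀ x * (_ * _) = _
    rw [inChart, Set.indicator_of_mem hx, hWdef]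
    change _ = f ((extChartAt (𝓡 n) m₀).symm x) * (volDensity g (m₀, 0) (x, t) * _)
    rw [← this, sliceDensity]
    ring
  have hfl : ∀ t, ∫ m, levelFlux g X T f t m ∂(sliceVolume g t) =
      ∫ x, fluxIntegrand (inChart m₀ f) W (x, t) := by
    intro t
    have e : ∫ x in (extChartAt (𝓡 n) m₀).target, fluxIntegrand (inChart m₀ f) W (x, t) =
        ∫ x, fluxIntegrand (inChart m₀ f) W (x, t) :=
      setIntegral_eq_integral_of_forall_compl_eq_zero fun x hx =>
        fluxIntegrand_eq_zero (y := (x, t)) fun h => hx (hχs h)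
    rw [integral_sliceVolume_of_support_subset g t m₀ (continuous_levelFlux g hX hT hTs hf t)
      ((support_levelFlux_subset g f t).trans hs), ← e]
    refine setIntegral_congr_fun hΩ.measurableSet fun x hx => ?_
    refine (sqrt_det_mul_lapse_mul_dScalar g X hTs hf hx t).trans ?_
    refine Finset.sum_congr rfl fun i _ => ?_
    rw [← (inChart_eventuallyEq hx f).fderiv_eq]
  constructor
  · rw [IntegralBalance, hρ, hρ]
    simp only [hfl]
    exact integral_continuity_equation hΩ hW hdiv hχ hχc hχs t₀ t₁
  · simp only [hfl]
    exact continuous_integral_fluxIntegrand hΩ hW hχ hχc hχs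

variable [T2Space M] [SecondCountableTopology M]

/-- The integrated continuity equation holds for all smooth test functions with compact support. -/
theorem integralBalance_of_hasCompactSupport (hX : X.Smooth) (hK : IsKilling g X) (hT : T.Smooth)
    (hTs : T.Symm) (hTc : IsConserved g T) (t₀ t₁ : ℝ)
    (hf : ContMDiff (𝓡 n) 𝓘(ℝ, ℝ) ∞ f) (hc : HasCompactSupport f) :
    IntegralBalance g X T t₀ t₁ f := by
  have : LocallyCompactSpace M := ChartedSpace.locallyCompactSpace (EuclideanSpace ℝ (Fin n)) M
  have hfin := fun t => isLocallyFiniteMeasure_sliceVolume g t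
  obtain ⟨ρ, hρ⟩ := SmoothPartitionOfUnity.exists_isSubordinate_chartAt_source (𝓡 n) M
  -- Only finitely many members of the partition meet the support of `f`, so `f` is a finite sum of
  -- functions each supported in a chart domain.
  have hfinite := ρ.locallyFinite.finite_nonempty_inter_compact hc
  have hsum : f = ∑ i ∈ hfinite.toFinset, fun m => ρ i m * f m := by
    ext m
    rw [Finset.sum_apply, ← Finset.sum_mul]
    by_cases hm : f m = 0
    · rw [hm, mul_zero]
    · rw [ρ.sum_finsupport' m (Set.mem_univ m), one_mul]
      intro i hi
      rw [ρ.mem_finsupport m] at hi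
      exact hfinite.mem_toFinset.2 ⟨m, hi, subset_tsupport f hm⟩
  -- The balance alone is not closed under addition: smoothness, compact support and continuity of
  -- the flux in time are carried along so that all the integrals can be split.
  have key : ContMDiff (𝓡 n) 𝓘(ℝ, ℝ) ∞ f ∧ HasCompactSupport f ∧ IntegralBalance g X T t₀ t₁ f ∧
      Continuous fun t => ∫ m, levelFlux g X T f t m ∂(sliceVolume g t) := by
    rw [hsum]
    refine Finset.sum_induction _ (fun f : M → ℝ => ContMDiff (𝓡 n) 𝓘(ℝ, ℝ) ∞ f ∧
      HasCompactSupport f ∧ IntegralBalance g X T t₀ t₁ f ∧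
        Continuous fun t => ∫ m, levelFlux g X T f t m ∂(sliceVolume g t)) ?_ ?_ ?_
    · rintro f₁ f₂ ⟨s₁, c₁, b₁, k₁⟩ ⟨s₂, c₂, b₂, k₂⟩
      have hi : ∀ {h : M → ℝ} (_ : ContMDiff (𝓡 n) 𝓘(ℝ, ℝ) ∞ h) (_ : HasCompactSupport h) (t : ℝ),
          Integrable (levelFlux g X T h t) (sliceVolume g t) := fun hs' hc' t =>
        (continuous_levelFlux g hX hT hTs hs' t).integrable_of_hasCompactSupport
          (HasCompactSupport.of_support_subset_isCompact hc' (support_levelFlux_subset g _ t))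
      have hj : ∀ {h : M → ℝ} (_ : ContMDiff (𝓡 n) 𝓘(ℝ, ℝ) ∞ h) (_ : HasCompactSupport h) (t : ℝ),
          Integrable (fun m => h m * energyDensity g X T t m) (sliceVolume g t) := fun hs' hc' t =>
        (hs'.continuous.mul (continuous_energyDensity g hX hT hTs t)).integrable_of_hasCompactSupport
          (hc'.mul_right)
      have hfl : ∀ t, ∫ m, levelFlux g X T (f₁ + f₂) t m ∂(sliceVolume g t) =
          (∫ m, levelFlux g X T f₁ t m ∂(sliceVolume g t)) +
            ∫ m, levelFlux g X T f₂ t m ∂(sliceVolume g t) := by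
        intro t
        simp only [levelFlux_add g s₁ s₂]
        exact integral_add (hi s₁ c₁ t) (hi s₂ c₂ t)
      refine ⟨s₁.add s₂, c₁.add c₂, ?_, by
        simp only [hfl]
        exact k₁.add k₂⟩
      rw [IntegralBalance] at b₁ b₂ ⊢
      simp only [hfl, Pi.add_apply, add_mul]
      rw [intervalIntegral.integral_add (k₁.intervalIntegrable _ _) (k₂.intervalIntegrable _ _),
        ← b₁, ← b₂, integral_add (hj s₁ c₁ t₁) (hj s₂ c₂ t₁),
        integral_add (hj s₁ c₁ t₀) (hj s₂ c₂ t₀)]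
      ring
    · have h0 : ∀ t m, levelFlux g X T (0 : M → ℝ) t m = 0 := levelFlux_const g 0
      refine ⟨contMDiff_const, HasCompactSupport.zero, ?_, ?_⟩
      · simp [IntegralBalance, h0]
      · simp only [h0, integral_zero]
        exact continuous_const
    · intro i _
      have hs : ContMDiff (𝓡 n) 𝓘(ℝ, ℝ) ∞ fun m => ρ i m * f m := (ρ i).contMDiff.mul hf
      have hc' : HasCompactSupport fun m => ρ i m * f m := hc.mul_left
      refine ⟨hs, hc', integralBalance_of_tsupport_subset (m₀ := i) g hX hK hT hTs hTc t₀ t₁ hs hc'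
        ((tsupport_mul_subset_left).trans ?_)⟩
      rw [extChartAt_source]
      exact hρ i
  exact key.2.2.1

end Global

/-! ### Conservation of the slice energy, and its identification with the flux. -/

section SliceEnergyConservation

variable [T2Space M] [SecondCountableTopology M] [IsManifold (𝓡 n) ∞ M] [MeasurableSpace M]
  [BorelSpace M] (g : SpacetimeMetric n M) {X : VField n M} {T : Tensor2 n M} {t₀ t₁ : ℝ}

theorem integrable_energyDensity_of_compactSpace [CompactSpace M] (hX : X.Smooth) (hT : T.Smooth)
    (hTs : T.Symm) (t : ℝ) : Integrable (energyDensity g X T t) (sliceVolume g t) :=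
  have := isLocallyFiniteMeasure_sliceVolume (n := n) g t
  (continuous_energyDensity g hX hT hTs t).integrable_of_hasCompactSupport
    (HasCompactSupport.of_compactSpace _)

/-- On a compact `M` the constant `1` is an admissible test function, and its level flux vanishes.
-/
theorem sliceEnergy_eq_of_compactSpace [CompactSpace M] (hX : X.Smooth) (hK : IsKilling g X)
    (hT : T.Smooth) (hTs : T.Symm) (hTc : IsConserved g T) :
    sliceEnergy g X T t₁ = sliceEnergy g X T t₀ := by
  have h := integralBalance_of_hasCompactSupport g hX hK hT hTs hTc t₀ t₁
    (f := fun _ => (1 : ℝ)) contMDiff_const (HasCompactSupport.of_compactSpace _)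
  simp only [IntegralBalance, one_mul, levelFlux_const, integral_zero,
    intervalIntegral.integral_zero] at h
  exact sub_eq_zero.1 h

/-- A smooth cutoff function that equals `1` below `1` and `0` above `2`. -/
def cutoff (s : ℝ) : ℝ := Real.smoothTransition (2 - s)

theorem contDiff_cutoff : ContDiff ℝ ∞ cutoff :=
  Real.smoothTransition.contDiff.comp (contDiff_const.sub contDiff_id)

/-- The derivative is continuous on `[1, 2]` and vanishes outside, where the cutoff is locally
constant. -/
theorem exists_abs_deriv_cutoff_le : ∃ C : ℝ, 0 ≤ C ∧ ∀ s, |deriv cutoff s| ≤ C := by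
  have hc : Continuous (deriv cutoff) := contDiff_cutoff.continuous_deriv (by simp)
  obtain ⟨C, hC⟩ := (isCompact_Icc (a := (1 : ℝ)) (b := 2)).exists_bound_of_continuousOn
    hc.continuousOn
  have hC0 : 0 ≤ C := (norm_nonneg _).trans (hC 1 (by norm_num))
  refine ⟨C, hC0, fun s => ?_⟩
  by_cases hs : s ∈ Set.Icc (1 : ℝ) 2
  · exact hC s hs
  · have h0 : deriv cutoff s = 0 := by
      rw [Set.mem_Icc, not_and_or, not_le, not_le] at hs
      rcases hs with hs | hs
      · have : cutoff =ᶠ[𝓝 s] fun _ => 1 := by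
          filter_upwards [Iio_mem_nhds hs] with z hz
          exact Real.smoothTransition.one_of_one_le (by linarith [Set.mem_Iio.1 hz])
        rw [this.deriv_eq, deriv_const]
      · have : cutoff =ᶠ[𝓝 s] fun _ => 0 := by
          filter_upwards [Ioi_mem_nhds hs] with z hz
          exact Real.smoothTransition.zero_of_nonpos (by linarith [Set.mem_Ioi.1 hz])
        rw [this.deriv_eq, deriv_const]
    rw [h0, abs_zero]
    exact hC0

omit [ChartedSpace (EuclideanSpace ℝ (Fin n)) M] [SecondCountableTopology M] [IsManifold (𝓡 n) ∞ M]
  [MeasurableSpace M] [BorelSpace M] in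
theorem hasCompactSupport_cutoff_comp {r : M → ℝ}
    (hr' : Filter.Tendsto r (Filter.cocompact M) Filter.atTop) {k : ℝ} (hk : 0 < k) :
    HasCompactSupport fun m => cutoff (r m / k) := by
  obtain ⟨K, hK, hKr⟩ := Filter.mem_cocompact.1 (hr'.eventually_gt_atTop (2 * k))
  refine HasCompactSupport.intro hK fun m hm => Real.smoothTransition.zero_of_nonpos ?_
  have : 2 * k < r m := hKr hm
  have := (lt_div_iff₀ hk).2 this
  linarith

/-- The cutoffs `η k` exhaust `M` while their gradients shrink like `1 / (k + 1)` relative to that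
of `r`. Integrable `P^α ∂_α r` then leaves no flux through infinity. -/
theorem sliceEnergy_eq_of_fallOff (hX : X.Smooth) (hK : IsKilling g X)
    (hT : T.Smooth) (hTs : T.Symm) (hTc : IsConserved g T) (ht : t₀ ≤ t₁)
    (hF : FallOff g X T t₀ t₁) : sliceEnergy g X T t₁ = sliceEnergy g X T t₀ := by
  obtain ⟨hi₀, hi₁, r, hr, hr', hfin⟩ := hF
  obtain ⟨C, hC0, hC⟩ := exists_abs_deriv_cutoff_le
  set J : ENNReal := ∫⁻ t in Set.Icc t₀ t₁, ∫⁻ m, ENNReal.ofReal (lapse g (m, t) *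
    |dScalar (n := n) (fun q : M × ℝ => r q.1) (m, t) (energyMomentum g X T (m, t))|)
      ∂(sliceVolume g t) with hJ
  -- The shift to `k + 1` keeps the scale positive from `k = 0` on.
  let η : ℕ → M → ℝ := fun k => (fun s => cutoff (s / (k + 1))) ∘ r
  have hθ : ∀ k : ℕ, ContDiff ℝ ∞ fun s : ℝ => cutoff (s / (k + 1)) := fun k =>
    contDiff_cutoff.comp (contDiff_id.div_const _)
  have hη : ∀ k, ContMDiff (𝓡 n) 𝓘(ℝ, ℝ) ∞ (η k) := fun k => (hθ k).contMDiff.comp hr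
  have hηc : ∀ k, HasCompactSupport (η k) := fun k =>
    hasCompactSupport_cutoff_comp hr' (Nat.cast_add_one_pos k)
  have hη1 : ∀ m, Filter.Tendsto (fun k => η k m) Filter.atTop (𝓝 1) := by
    intro m
    refine tendsto_const_nhds.congr' ?_
    filter_upwards [Filter.eventually_ge_atTop ⌈r m⌉₊] with k hk
    have h1 : r m ≤ k := Nat.ceil_le.1 hk
    have h2 : r m / (k + 1) ≤ 1 := (div_le_one (Nat.cast_add_one_pos k)).2 (by linarith)
    exact (Real.smoothTransition.one_of_one_le (by linarith)).symm
  have hlim : ∀ t, Integrable (energyDensity g X T t) (sliceVolume g t) →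
      Filter.Tendsto (fun k => ∫ m, η k m * energyDensity g X T t m ∂(sliceVolume g t))
        Filter.atTop (𝓝 (sliceEnergy g X T t)) := by
    intro t hi
    refine tendsto_integral_of_dominated_convergence (fun m => ‖energyDensity g X T t m‖)
      (fun k => ((hη k).continuous.mul
        (continuous_energyDensity g hX hT hTs t)).aestronglyMeasurable) hi.norm
      (fun k => Filter.Eventually.of_forall fun m => ?_) (Filter.Eventually.of_forall fun m => ?_)
    · rw [norm_mul]
      refine mul_le_of_le_one_left (norm_nonneg _) ?_
      have h0 : 0 ≤ η k m := Real.smoothTransition.nonneg _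
      rw [Real.norm_of_nonneg h0]
      exact Real.smoothTransition.le_one _
    · simpa using (hη1 m).mul_const (energyDensity g X T t m)
  -- The estimate uses integrals in `ENNReal`, whose inequalities here require no measurability in
  -- `t` of the slice integrals.
  have hbound : ∀ k : ℕ, ‖∫ t in t₀..t₁, ∫ m, levelFlux g X T (η k) t m ∂(sliceVolume g t)‖ₑ ≤
      ENNReal.ofReal (C / (k + 1)) * J := by
    intro k
    have hpt : ∀ t m, ‖levelFlux g X T (η k) t m‖ₑ ≤ ENNReal.ofReal (C / (k + 1)) *
        ENNReal.ofReal (lapse g (m, t) * |dScalar (n := n) (fun q : M × ℝ => r q.1) (m, t)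
          (energyMomentum g X T (m, t))|) := by
      intro t m
      have hpos : (0 : ℝ) < k + 1 := Nat.cast_add_one_pos k
      -- The chain rule yields the factor `1 / (k + 1)` that drives the limit.
      have hd : deriv (fun s : ℝ => cutoff (s / (k + 1))) (r m) =
          deriv cutoff (r m / (k + 1)) / (k + 1) := by
        have h1 := ((contDiff_cutoff.differentiable (by simp) (r m / (k + 1))).hasDerivAt).comp (r m)
          ((hasDerivAt_id (r m)).div_const ((k : ℝ) + 1))
        rw [show (fun s : ℝ => cutoff (s / (k + 1))) = cutoff ∘ fun s => id s / (k + 1) from rfl,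
          h1.deriv]
        ring
      rw [levelFlux_comp g hr ((hθ k).differentiable (by simp)), hd, enorm_mul,
        Real.enorm_eq_ofReal_abs, Real.enorm_eq_ofReal_abs]
      refine mul_le_mul' (ENNReal.ofReal_le_ofReal ?_) (le_of_eq ?_)
      · rw [abs_div, abs_of_pos hpos]
        exact div_le_div_of_nonneg_right (hC _) hpos.le
      · rw [levelFlux, abs_mul, abs_of_pos (lapse_pos g _)]
    rw [intervalIntegral.integral_of_le ht]
    calc _ ≤ ∫⁻ t in Set.Ioc t₀ t₁, ‖∫ m, levelFlux g X T (η k) t m ∂(sliceVolume g t)‖ₑ :=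
          enorm_integral_le_lintegral_enorm _
      _ ≤ ∫⁻ t in Set.Icc t₀ t₁, ‖∫ m, levelFlux g X T (η k) t m ∂(sliceVolume g t)‖ₑ :=
          lintegral_mono_set Set.Ioc_subset_Icc_self
      _ ≤ ∫⁻ t in Set.Icc t₀ t₁, ENNReal.ofReal (C / (k + 1)) *
            ∫⁻ m, ENNReal.ofReal (lapse g (m, t) * |dScalar (n := n) (fun q : M × ℝ => r q.1)
              (m, t) (energyMomentum g X T (m, t))|) ∂(sliceVolume g t) := by
          refine lintegral_mono fun t => (enorm_integral_le_lintegral_enorm _).trans ?_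
          rw [← lintegral_const_mul' _ _ ENNReal.ofReal_ne_top]
          exact lintegral_mono fun m => hpt t m
      _ = _ := by rw [lintegral_const_mul' _ _ ENNReal.ofReal_ne_top, hJ]
  have hzero : Filter.Tendsto
      (fun k : ℕ => ∫ t in t₀..t₁, ∫ m, levelFlux g X T (η k) t m ∂(sliceVolume g t))
        Filter.atTop (𝓝 0) := by
    rw [tendsto_zero_iff_norm_tendsto_zero]
    have h1 : ∀ k : ℕ, ‖∫ t in t₀..t₁, ∫ m, levelFlux g X T (η k) t m ∂(sliceVolume g t)‖ ≤
        C * J.toReal * (1 / ((k : ℝ) + 1)) := by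
      intro k
      have hpos : (0 : ℝ) ≤ C / (k + 1) := div_nonneg hC0 (Nat.cast_add_one_pos k).le
      have := ENNReal.toReal_mono (ENNReal.mul_ne_top ENNReal.ofReal_ne_top hfin.ne) (hbound k)
      rw [toReal_enorm, ENNReal.toReal_mul, ENNReal.toReal_ofReal hpos] at this
      refine this.trans (le_of_eq ?_)
      ring
    refine squeeze_zero (fun _ => norm_nonneg _) h1 ?_
    simpa using (tendsto_one_div_add_atTop_nhds_zero_nat (𝕜 := ℝ)).const_mul (C * J.toReal)
  have hbal := fun k =>
    integralBalance_of_hasCompactSupport g hX hK hT hTs hTc t₀ t₁ (hη k) (hηc k)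
  simp only [IntegralBalance] at hbal
  have h := (hlim t₁ hi₁).sub (hlim t₀ hi₀)
  simp only [hbal] at h
  exact sub_eq_zero.1 (tendsto_nhds_unique h hzero)

omit [SecondCountableTopology M] [T2Space M] [IsManifold (𝓡 n) ∞ M] [MeasurableSpace M]
  [BorelSpace M] in
-- Pairing `P` with `N` undoes the raised index, so each energy density is `T(X, N)`; the Einstein
-- equations at `(X, N)` do the rest.
theorem fluxDensity_eq_add {Tφ Tψ : Tensor2 n M}
    (hE : ∀ (p : M × ℝ) (u v : TangentSpace (𝓘st n) p), einstein g p u v = Tφ p u v + Tψ p u v)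
    (t : ℝ) : fluxDensity g X t = energyDensity g X Tφ t + energyDensity g X Tψ t := by
  ext m
  rw [Pi.add_apply, energyDensity_eq_apply, energyDensity_eq_apply, fluxDensity, hE]

end SliceEnergyConservation

end SliceEnergy

end

/-! ### The main theorem. -/

open SliceEnergy in
theorem theorem1 {n : ℕ} {M : Type*} [TopologicalSpace M] [T2Space M]
    [SecondCountableTopology M] [ChartedSpace (EuclideanSpace ℝ (Fin n)) M]
    [IsManifold (𝓡 n) ∞ M] [MeasurableSpace M] [BorelSpace M]
    -- the spacetime metric on `M × ℝ` and the causal vector field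
    (g : SpacetimeMetric n M) (X : VField n M) (hX : X.Smooth) (hXc : IsCausal g X)
    -- the scalar field with its potential, and the stress tensor of the matter field
    (V : ℝ → ℝ) (hV : ContDiff ℝ ∞ V)
    (φ : M × ℝ → ℝ) (hφ : ContMDiff (𝓘st n) 𝓘(ℝ, ℝ) ∞ φ)
    (Tψ : Tensor2 n M) (hTψ : Tψ.Smooth) (hTψs : Tψ.Symm)
    -- the Einstein equations and the conservation identities
    (hE : ∀ (p : M × ℝ) (u v : TangentSpace (𝓘st n) p),
      einstein g p u v = scalarStress g V φ p u v + Tψ p u v)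
    (hcφ : IsConserved g (scalarStress g V φ)) (hcψ : IsConserved g Tψ)
    -- the end slices; compactness or fall-off
    (t₀ t₁ : ℝ) (ht : t₀ ≤ t₁)
    (hM : CompactSpace M ∨
      (FallOff g X (scalarStress g V φ) t₀ t₁ ∧ FallOff g X Tψ t₀ t₁)) :
    -- all the integrals exist
    (∀ t ∈ ({t₀, t₁} : Set ℝ),
      MeasureTheory.Integrable (energyDensity g X (scalarStress g V φ) t) (sliceVolume g t) ∧
      MeasureTheory.Integrable (energyDensity g X Tψ t) (sliceVolume g t) ∧
      MeasureTheory.Integrable (fluxDensity g X t) (sliceVolume g t)) ∧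
    -- the change of the total slice energy is the difference of the gravitational fluxes
    totalSliceEnergy g X (scalarStress g V φ) Tψ t₁
        - totalSliceEnergy g X (scalarStress g V φ) Tψ t₀
      = gravFlux g X t₁ - gravFlux g X t₀ ∧
    -- conservation for a Killing field
    (IsKilling g X →
      totalSliceEnergy g X (scalarStress g V φ) Tψ t₁
        = totalSliceEnergy g X (scalarStress g V φ) Tψ t₀) := by
  have hTφ := scalarStress_smooth g hV hφ
  have hTφs := scalarStress_symm g V φ
  have hint : ∀ t ∈ ({t₀, t₁} : Set ℝ),
      Integrable (energyDensity g X (scalarStress g V φ) t) (sliceVolume g t) ∧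
        Integrable (energyDensity g X Tψ t) (sliceVolume g t) := by
    intro t hmem
    rcases hM with hM | ⟨hFφ, hFψ⟩
    · exact ⟨integrable_energyDensity_of_compactSpace g hX hTφ hTφs t,
        integrable_energyDensity_of_compactSpace g hX hTψ hTψs t⟩
    · rcases hmem with rfl | rfl
      · exact ⟨hFφ.1, hFψ.1⟩
      · exact ⟨hFφ.2.1, hFψ.2.1⟩
  -- The pointwise identity of densities integrates on each end slice; existence of both energies is
  -- needed to split the integral.
  have hflux : ∀ t ∈ ({t₀, t₁} : Set ℝ),
      gravFlux g X t = totalSliceEnergy g X (scalarStress g V φ) Tψ t := by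
    intro t hmem
    rw [gravFlux, fluxDensity_eq_add g hE]
    exact integral_add (hint t hmem).1 (hint t hmem).2
  refine ⟨fun t hmem => ⟨(hint t hmem).1, (hint t hmem).2, ?_⟩, ?_, fun hK => ?_⟩
  · rw [fluxDensity_eq_add g hE]
    exact (hint t hmem).1.add (hint t hmem).2
  · rw [hflux t₁ (by simp), hflux t₀ (by simp)]
  -- For a Killing field each energy is conserved by itself, since each stress tensor is divergence
  -- free on its own.
  · rcases hM with hM | ⟨hFφ, hFψ⟩
    · rw [totalSliceEnergy, totalSliceEnergy,
        sliceEnergy_eq_of_compactSpace g hX hK hTφ hTφs hcφ (t₀ := t₀),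
        sliceEnergy_eq_of_compactSpace g hX hK hTψ hTψs hcψ (t₀ := t₀)]
    · rw [totalSliceEnergy, totalSliceEnergy,
        sliceEnergy_eq_of_fallOff g hX hK hTφ hTφs hcφ ht hFφ,
        sliceEnergy_eq_of_fallOff g hX hK hTψ hTψs hcψ ht hFψ]
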